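/- Let $(\mathcal T_t)_{t\ge 0}$ be a symmetric (sub-)Markov semigroup on the real space $L^2(\mathbb R^N)$ (Lebesgue measure), i.e. a strongly continuous semigroup of bounded symmetric contractions such that $0\le f\le 1$ a.e. implies $0\le \mathcal T_tf\le 1$ a.e. Let $\mathcal Q$ be its Dirichlet form, $\mathcal Q(f,f)=\lim_{t\to0^+}t^{-1}\langle f-\mathcal T_tf,f\rangle$, whose domain $\mathfrak D$ is the set of $f\in L^2(\mathbb R^N)$ for which this limit exists and is finite; thus $\mathcal Q(f,f)=\langle Af,f\rangle$ for $f$ in the domain of the positive self-adjoint operator $A$ with $\mathcal T_t=e^{-tA}$. For $v\in L^1(\mathbb R^N)$, $\mathcal T_tv$ denotes the value at $v$ of the continuous extension to $L^1(\mathbb R^N)$ of $\mathcal T_t|_{L^1\cap L^2}$. Assume that there are constants $1\le r<2$, $d>0$ and $C_1>0$ such that every $f\in\mathfrak D\cap L^1(\mathbb R^N)$ with $\|f\|_r=1$ satisfies $$\mathcal Q(f,f)\ \ge\ C_1\,\|f\|_2^2\,\min\{1,\|f\|_2^{2/d}\}.$$ Then for all $1\le q<p<\infty$ there is a constant $C_2>0$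 such that for every $v\in L^1(\mathbb R^N)\cap L^p(\mathbb R^N)$ there is a time $t_0>0$ (which may depend on $v$) with $$\|\mathcal T_tv\|_p\ \le\ C_2\,t^{-\varrho(q,p)}\,\|v\|_q\qquad\text{for all } t>t_0,\qquad \varrho(q,p)=\frac{dr}{2-r}\Big(\frac1q-\frac1p\Big).$$ -/

import Mathlib

open MeasureTheory Filter Topology
open scoped ENNReal NNReal InnerProductSpace

noncomputable section

/-- A symmetric (sub-)Markov semigroup on `L²(α, μ)`: a strongly continuous semigroup
`(T_t)_{t ≥ 0}` of bounded symmetric contractions on the real space `L²(α, μ)` such that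
`0 ≤ f ≤ 1` implies `0 ≤ T_t f ≤ 1`. These are exactly the semigroups `T_t = e^{-tA}` of
positive self-adjoint operators `A` on `L²` whose quadratic form is a Dirichlet form. -/
structure SymmMarkovSemigroup {α : Type*} [MeasurableSpace α] (μ : Measure α) where
  /-- the operators `T_t` on `L²` -/
  op : ℝ≥0 → Lp ℝ 2 μ →L[ℝ] Lp ℝ 2 μ
  op_zero : op 0 = ContinuousLinearMap.id ℝ (Lp ℝ 2 μ)
  op_add : ∀ s t, op (s + t) = (op s).comp (op t)
  continuous_op : ∀ f, Continuous fun t => op t f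
  norm_op_le : ∀ t f, ‖op t f‖ ≤ ‖f‖
  symm : ∀ t f g, ⟪op t f, g⟫_ℝ = ⟪f, op t g⟫_ℝ
  markov : ∀ t (f : Lp ℝ 2 μ), (∀ᵐ x ∂μ, 0 ≤ f x ∧ f x ≤ 1) →
    ∀ᵐ x ∂μ, 0 ≤ op t f x ∧ op t f x ≤ 1

namespace SymmMarkovSemigroup

variable {α : Type*} [MeasurableSpace α] {μ : Measure α} (T : SymmMarkovSemigroup μ)

/-- The approximating form `Q_t(f, g) = t⁻¹ ⟨f - T_t f, g⟩`. -/
def approxForm (t : ℝ≥0) (f g : Lp ℝ 2 μ) : ℝ := (t : ℝ)⁻¹ * ⟪f - T.op t f, g⟫_ℝ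

/-- The domain of the Dirichlet form of the semigroup: all `f ∈ L²` for which
`t⁻¹ ⟨f - T_t f, f⟩` has a finite limit as `t → 0⁺`. -/
def formDomain : Set (Lp ℝ 2 μ) :=
  {f | ∃ l : ℝ, Tendsto (fun t : ℝ≥0 => T.approxForm t f f) (𝓝[>] 0) (𝓝 l)}

/-- The Dirichlet form of the semigroup, `Q(f, g) = lim_{t → 0⁺} t⁻¹ ⟨f - T_t f, g⟩`
(for `f, g` in the domain of the form). -/
def form (f g : Lp ℝ 2 μ) : ℝ :=
  limUnder (𝓝[>] (0 : ℝ≥0)) fun t => T.approxForm t f g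

/-- If `-A` is the generator of the semigroup and `f` lies in the domain of `A`,
then `Q(f, g) = ⟨A f, g⟩` for every `g ∈ L²`. -/
theorem form_eq_of_generator {f Af : Lp ℝ 2 μ}
    (h : Tendsto (fun t : ℝ≥0 => (t : ℝ)⁻¹ • (f - T.op t f)) (𝓝[>] 0) (𝓝 Af))
    (g : Lp ℝ 2 μ) : T.form f g = ⟪Af, g⟫_ℝ := by
  apply Tendsto.limUnder_eq
  have h2 := h.inner (𝕜 := ℝ) (tendsto_const_nhds (x := g))
  simpa only [approxForm, real_inner_smul_left] using h2

theorem abs_op_indicator_sub_le (t : ℝ≥0) {A B : Set α} (hA : MeasurableSet A)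
    (hB : MeasurableSet B) (hμA : μ A ≠ ∞) (hμB : μ B ≠ ∞) :
    ∀ᵐ x ∂μ, |op T t (indicatorConstLp 2 hA hμA 1) x
      - op T t (indicatorConstLp 2 hB hμB 1) x| ≤ 1 := by
  have key : ∀ {S : Set α} (hS : MeasurableSet S) (hμS : μ S ≠ ∞),
      ∀ᵐ x ∂μ, 0 ≤ op T t (indicatorConstLp 2 hS hμS 1) x ∧
        op T t (indicatorConstLp 2 hS hμS 1) x ≤ 1 := by
    intro S hS hμS
    apply T.markov
    filter_upwards [indicatorConstLp_coeFn (p := 2) (hs := hS) (hμs := hμS) (c := (1 : ℝ))]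
      with x hx
    rw [hx]
    by_cases h : x ∈ S <;> simp [h]
  filter_upwards [key hA hμA, key hB hμB] with x h1 h2
  rw [abs_le]
  constructor <;> linarith [h1.1, h1.2, h2.1, h2.2]

/-- Each `T_t` contracts the `L¹` norm on `L¹ ∩ L²`. -/
theorem eLpNorm_one_op_le (t : ℝ≥0) (f : Lp ℝ 2 μ) (hf : MemLp f 1 μ) :
    eLpNorm (T.op t f) 1 μ ≤ eLpNorm f 1 μ := by
  set g : Lp ℝ 2 μ := T.op t f with hg
  have hgm : Measurable g := (Lp.stronglyMeasurable g).measurable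
  have hfi : Integrable f μ := memLp_one_iff_integrable.1 hf
  have hlev : ∀ ε : ℝ, 0 < ε → μ {x | ε ≤ |g x|} ≠ ∞ := by
    intro ε hε
    have := (Lp.memLp g).meas_ge_lt_top' (by norm_num) (by norm_num)
      (ε := ENNReal.ofReal ε) (by simpa using hε)
    refine ne_of_lt (lt_of_le_of_lt (measure_mono ?_) this)
    intro x hx
    change ENNReal.ofReal ε ≤ ‖g x‖ₑ
    rw [← ofReal_norm]
    exact ENNReal.ofReal_le_ofReal hx
  have hstep : ∀ ε : ℝ, 0 < ε → ∫⁻ x in {x | ε ≤ |g x|}, ‖g x‖ₑ ∂μ ≤ eLpNorm f 1 μ := by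
    intro ε hε
    have hA : MeasurableSet {x | ε ≤ g x} := measurableSet_le measurable_const hgm
    have hB : MeasurableSet {x | g x ≤ -ε} := measurableSet_le hgm measurable_const
    have hμA : μ {x | ε ≤ g x} ≠ ∞ := ne_top_of_le_ne_top (hlev ε hε)
      (measure_mono fun x hx => le_trans (show ε ≤ g x from hx) (le_abs_self (g x)))
    have hμB : μ {x | g x ≤ -ε} ≠ ∞ := ne_top_of_le_ne_top (hlev ε hε)
      (measure_mono fun x hx => by
        have hx' : g x ≤ -ε := hx
        exact le_trans (by linarith) (neg_le_abs (g x)))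
    have hE : MeasurableSet {x | ε ≤ |g x|} := measurableSet_le measurable_const hgm.abs
    have hgA : IntegrableOn g {x | ε ≤ g x} μ :=
      integrableOn_Lp_of_measure_ne_top g fact_one_le_two_ennreal.elim hμA
    have hgB : IntegrableOn g {x | g x ≤ -ε} μ :=
      integrableOn_Lp_of_measure_ne_top g fact_one_le_two_ennreal.elim hμB
    have hgE : IntegrableOn g {x | ε ≤ |g x|} μ :=
      integrableOn_Lp_of_measure_ne_top g fact_one_le_two_ennreal.elim (hlev ε hε)
    have e1 : ∫ x in {x | ε ≤ |g x|}, |g x| ∂μ =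
        ⟪indicatorConstLp 2 hA hμA (1 : ℝ) - indicatorConstLp 2 hB hμB (1 : ℝ), g⟫_ℝ := by
      rw [inner_sub_left, L2.inner_indicatorConstLp_one, L2.inner_indicatorConstLp_one,
        ← integral_indicator hE, ← integral_indicator hA, ← integral_indicator hB,
        ← integral_sub (hgA.integrable_indicator hA) (hgB.integrable_indicator hB)]
      congr 1
      funext x
      simp only [Set.indicator_apply, Set.mem_ofPred_eq, le_abs']
      rcases abs_cases (g x) with ⟨h, h'⟩ | ⟨h, h'⟩ <;> rw [h] <;> split_ifs <;>
        first
          | (exfalso; tauto)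
          | (exfalso; linarith)
          | ring
    have e2 : ⟪indicatorConstLp 2 hA hμA (1 : ℝ) - indicatorConstLp 2 hB hμB (1 : ℝ), g⟫_ℝ =
        ∫ x, ⟪(T.op t (indicatorConstLp 2 hA hμA 1) - T.op t (indicatorConstLp 2 hB hμB 1) :
          Lp ℝ 2 μ) x, f x⟫_ℝ ∂μ := by
      exact (T.symm t _ f).symm.trans (by rw [map_sub, L2.inner_def])
    have e3 : ∫ x in {x | ε ≤ |g x|}, |g x| ∂μ ≤ ∫ x, |f x| ∂μ := by
      rw [e1, e2]
      refine le_trans (Real.le_norm_self _) (norm_integral_le_of_norm_le hfi.abs ?_)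
      filter_upwards [T.abs_op_indicator_sub_le t hA hB hμA hμB,
        Lp.coeFn_sub (T.op t (indicatorConstLp 2 hA hμA 1))
          (T.op t (indicatorConstLp 2 hB hμB 1))] with x h1 h2
      rw [h2, Pi.sub_apply]
      refine le_trans (norm_inner_le_norm _ _) ?_
      simp only [Real.norm_eq_abs]
      exact mul_le_of_le_one_left (abs_nonneg _) h1
    have e4 : ∫⁻ x in {x | ε ≤ |g x|}, ‖g x‖ₑ ∂μ =
        ENNReal.ofReal (∫ x in {x | ε ≤ |g x|}, |g x| ∂μ) :=
      (ofReal_integral_norm_eq_lintegral_enorm hgE).symm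
    have e5 : eLpNorm f 1 μ = ENNReal.ofReal (∫ x, |f x| ∂μ) := by
      rw [eLpNorm_one_eq_lintegral_enorm]
      exact (ofReal_integral_norm_eq_lintegral_enorm hfi).symm
    rw [e4, e5]
    exact ENNReal.ofReal_le_ofReal e3
  rw [eLpNorm_one_eq_lintegral_enorm]
  have hU : ∫⁻ x, ‖g x‖ₑ ∂μ =
      ∫⁻ x in ⋃ n : ℕ, {x | 1 / ((n : ℝ) + 1) ≤ |g x|}, ‖g x‖ₑ ∂μ := by
    symm
    apply setLIntegral_eq_of_support_subset
    intro x hx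
    have hx' : 0 < |g x| := by
      simpa [Function.mem_support] using hx
    obtain ⟨n, hn⟩ := exists_nat_one_div_lt hx'
    exact Set.mem_iUnion.2 ⟨n, hn.le⟩
  rw [hU, setLIntegral_iUnion_of_directed]
  · exact iSup_le fun n => hstep _ (by positivity)
  · apply Monotone.directed_le
    intro m n hmn x hx
    refine le_trans ?_ (show 1 / ((m : ℝ) + 1) ≤ |g x| from hx)
    gcongr

/-- The subspace `L¹ ∩ L²` of `L¹`. -/
def l1l2 (μ : Measure α) : Submodule ℝ (Lp ℝ 1 μ) where
  carrier := {f | MemLp f 2 μ}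
  zero_mem' := (memLp_congr_ae (Lp.coeFn_zero ℝ 1 μ)).2 MemLp.zero
  add_mem' := fun {f g} hf hg => (memLp_congr_ae (Lp.coeFn_add f g)).2 (MemLp.add hf hg)
  smul_mem' := fun c f hf => (memLp_congr_ae (Lp.coeFn_smul c f)).2 (MemLp.const_smul hf c)

theorem memLp_two (f : l1l2 μ) : MemLp (f : Lp ℝ 1 μ) 2 μ := f.2

/-- The inclusion of `L¹ ∩ L²` in `L²`. -/
def toL2 : l1l2 μ →ₗ[ℝ] Lp ℝ 2 μ where
  toFun f := (memLp_two f).toLp _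
  map_add' f g := by
    rw [← MemLp.toLp_add (memLp_two f) (memLp_two g)]
    exact (MemLp.toLp_eq_toLp_iff _ _).2 (Lp.coeFn_add _ _)
  map_smul' c f := by
    rw [RingHom.id_apply, ← MemLp.toLp_const_smul c (memLp_two f)]
    exact (MemLp.toLp_eq_toLp_iff _ _).2 (Lp.coeFn_smul _ _)

theorem toL2_ae_eq (f : l1l2 μ) : toL2 f =ᵐ[μ] (f : Lp ℝ 1 μ) := MemLp.coeFn_toLp (memLp_two f)

theorem memLp_one_op_toL2 (t : ℝ≥0) (f : l1l2 μ) : MemLp (T.op t (toL2 f)) 1 μ := by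
  have h : MemLp (toL2 f) 1 μ := (memLp_congr_ae (toL2_ae_eq f)).2 (Lp.memLp _)
  exact ⟨Lp.aestronglyMeasurable _, lt_of_le_of_lt (T.eLpNorm_one_op_le t _ h) h.2⟩

/-- The operator `T_t`, restricted to `L¹ ∩ L²` and regarded as a map into `L¹`. -/
def preOpL1 (t : ℝ≥0) : l1l2 μ →ₗ[ℝ] Lp ℝ 1 μ where
  toFun f := (T.memLp_one_op_toL2 t f).toLp _
  map_add' f g := by
    rw [← MemLp.toLp_add (T.memLp_one_op_toL2 t f) (T.memLp_one_op_toL2 t g),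
      MemLp.toLp_eq_toLp_iff, map_add, map_add]
    exact Lp.coeFn_add _ _
  map_smul' c f := by
    rw [RingHom.id_apply, ← MemLp.toLp_const_smul c (T.memLp_one_op_toL2 t f),
      MemLp.toLp_eq_toLp_iff, map_smul, map_smul]
    exact Lp.coeFn_smul _ _

theorem norm_preOpL1_le (t : ℝ≥0) (f : l1l2 μ) :
    ‖T.preOpL1 t f‖ ≤ 1 * ‖(l1l2 μ).subtype f‖ := by
  rw [one_mul, Submodule.subtype_apply, Lp.norm_def, Lp.norm_def]
  refine ENNReal.toReal_mono (Lp.eLpNorm_ne_top _) ?_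
  have h := toL2_ae_eq f
  refine le_of_eq_of_le (eLpNorm_congr_ae (MemLp.coeFn_toLp (T.memLp_one_op_toL2 t f))) ?_
  refine le_of_le_of_eq (T.eLpNorm_one_op_le t _ ?_) (eLpNorm_congr_ae h)
  exact (memLp_congr_ae h).2 (Lp.memLp _)

theorem denseRange_l1l2 : DenseRange (l1l2 μ).subtype := by
  have h : Dense (Lp.simpleFunc ℝ 1 μ : Set (Lp ℝ 1 μ)) := Lp.simpleFunc.dense (by norm_num)
  have hsub : (Lp.simpleFunc ℝ 1 μ : Set (Lp ℝ 1 μ)) ⊆ Set.range (l1l2 μ).subtype := by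
    intro f hf
    refine ⟨⟨f, ?_⟩, rfl⟩
    let s : Lp.simpleFunc ℝ 1 μ := ⟨f, hf⟩
    have hs : MemLp (Lp.simpleFunc.toSimpleFunc s) 1 μ := Lp.simpleFunc.memLp s
    have h2 : MemLp (Lp.simpleFunc.toSimpleFunc s) 2 μ :=
      (SimpleFunc.memLp_iff (by norm_num) (by norm_num)).2
        ((SimpleFunc.memLp_iff (by norm_num) (by norm_num)).1 hs)
    exact (memLp_congr_ae (Lp.simpleFunc.toSimpleFunc_eq_toFun s)).1 h2
  exact h.mono hsub

/-- The operator `T_t` on `L¹`: the unique continuous extension to `L¹` of the restriction of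
`T_t` to `L¹ ∩ L²`. -/
def opL1 (t : ℝ≥0) : Lp ℝ 1 μ →L[ℝ] Lp ℝ 1 μ := (T.preOpL1 t).extendOfNorm (l1l2 μ).subtype

/-- On `L¹ ∩ L²` the extension agrees with `T_t`. -/
theorem opL1_ae_eq (t : ℝ≥0) (v : Lp ℝ 1 μ) (hv : MemLp v 2 μ) :
    T.opL1 t v =ᵐ[μ] T.op t (hv.toLp v) := by
  have h : T.opL1 t v = T.preOpL1 t ⟨v, hv⟩ :=
    LinearMap.extendOfNorm_eq denseRange_l1l2 ⟨1, T.norm_preOpL1_le t⟩ ⟨v, hv⟩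
  rw [h]
  exact MemLp.coeFn_toLp (T.memLp_one_op_toL2 t ⟨v, hv⟩)

end SymmMarkovSemigroup

end

/-! Interpolating `‖f‖_r` between `L¹` and `L²` turns the hypothesis into a Nash inequality with the
`L¹` norm and the exponent `D = d r / (2 - r)` (`hasNashInequality_of_norm_eq_one`). The semigroup
contracts `L¹`, so for `‖f‖₁ ≤ K` the convex function `y(t) = ⟨T_t f, f⟩ / K²` satisfies a
difference form of `y' ≤ -C y min(1, y^(1/D))`. While `y ≥ 1` it decays exponentially, afterwards
like `t^(-D)`. Hence `T_t` maps `L¹` to `L²` with norm of order `t^(-D/2)`, up to an error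
`e^(-Ct/2) ‖f‖₂` (`norm_op_le`). The cut-off `min` allows no smoothing at small times, and this
error is its trace.

Since `v` need not lie in `L²`, the error must be converted into one measured in the target norm
`L^p`. By duality `T_t` maps `L²` to `L^∞` up to an exponentially small `L²` remainder
(`exists_op_le_const_add`). Jensen's inequality for `T_t` carries this to `L^(s')`, with remainder
in `L^(s')`, and pairing with `v` gives `L¹ → L^s` for `1 < s ≤ 2` with an error in `L^s`
(`integral_truncation_le`). This is the shape recorded in `HasDecay`.

That shape is stable: applying it to `f^q` and using `(T_t f)^q ≤ T_t (f^q)` gives `L^q → L^(sq)` at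
the right rate, and the semigroup law composes two such bounds. So every pair `q < p` is reached.
For a fixed `v ≠ 0` with both norms finite, the exponential error is eventually below `t^(-ϱ)
‖v‖_q`, at a time depending on `‖v‖_p / ‖v‖_q`; that is why `t₀` depends on `v` while the constant
does not. -/

/-! ### Real-variable lemmas: convexity and decay of differential inequalities -/

/-- A continuous midpoint convex function on a convex subset of the line is convex. -/
theorem convexOn_of_continuousOn_of_midpoint {s : Set ℝ} (hs : Convex ℝ s) {f : ℝ → ℝ}
    (hf : ContinuousOn f s)
    (hmid : ∀ x ∈ s, ∀ y ∈ s, f ((x + y) / 2) ≤ (f x + f y) / 2) : ConvexOn ℝ s f := by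
  refine ⟨hs, fun x hx y hy a b ha hb hab => ?_⟩
  have hmem : ∀ θ ∈ Set.Icc (0 : ℝ) 1, (1 - θ) * x + θ * y ∈ s := fun θ hθ =>
    hs hx hy (by linarith [hθ.2]) hθ.1 (by ring)
  set g : ℝ → ℝ := fun θ => f ((1 - θ) * x + θ * y) - ((1 - θ) * f x + θ * f y) with hg
  have hgc : ContinuousOn g (Set.Icc 0 1) := by
    refine ContinuousOn.sub (hf.comp (by fun_prop) hmem) (by fun_prop)
  have hgm : ∀ u ∈ Set.Icc (0 : ℝ) 1, ∀ v ∈ Set.Icc (0 : ℝ) 1,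
      g ((u + v) / 2) ≤ (g u + g v) / 2 := by
    intro u hu v hv
    have h := hmid _ (hmem u hu) _ (hmem v hv)
    have e : ((1 - u) * x + u * y + ((1 - v) * x + v * y)) / 2 =
        (1 - (u + v) / 2) * x + (u + v) / 2 * y := by ring
    rw [e] at h
    simp only [hg]
    linarith
  -- A maximum point `m` is the midpoint of an endpoint, where `g` vanishes, and a point of `[0,
  -- 1]`; hence `g m ≤ g m / 2`.
  obtain ⟨m, hm, hmax⟩ := isCompact_Icc.exists_isMaxOn (Set.nonempty_Icc.2 zero_le_one) hgc
  have h0 : g 0 = 0 := by simp [hg]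
  have h1 : g 1 = 0 := by simp [hg]
  have hle : g m ≤ 0 := by
    rcases le_total m (1 / 2) with h | h
    · have h2 : 2 * m ∈ Set.Icc (0 : ℝ) 1 := ⟨by linarith [hm.1], by linarith⟩
      have h3 := hgm 0 (by simp) (2 * m) h2
      have h4 : g (2 * m) ≤ g m := hmax h2
      rw [show (0 + 2 * m) / 2 = m by ring] at h3
      linarith
    · have h2 : 2 * m - 1 ∈ Set.Icc (0 : ℝ) 1 := ⟨by linarith, by linarith [hm.2]⟩
      have h3 := hgm 1 (by simp) (2 * m - 1) h2
      have h4 : g (2 * m - 1) ≤ g m := hmax h2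
      rw [show (1 + (2 * m - 1)) / 2 = m by ring] at h3
      linarith
  have hb1 : b ∈ Set.Icc (0 : ℝ) 1 := ⟨hb, by linarith⟩
  have h5 : g b ≤ g m := hmax hb1
  have ea : a = 1 - b := by linarith
  simp only [hg, smul_eq_mul, ea] at h5 hle ⊢
  linarith

/-- Discrete form of the differential inequality `dy/dt ≤ -C y^(1+1/D)`, with `y(0) ≤ 1`. -/
theorem le_rpow_of_polynomial_decrease {y : ℝ → ℝ} {C D : ℝ} (hC : 0 < C) (hD : 0 < D)
    (hy0 : ∀ t, 0 ≤ t → 0 ≤ y t) (hy1 : ∀ t, 0 ≤ t → y t ≤ 1)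
    (hy : ∀ a b, 0 ≤ a → a < b → y b * (1 + C * (b - a) * y b ^ (1 / D)) ≤ y a)
    {t : ℝ} (ht : 0 < t) : y t ≤ (2 * 4 ^ D / C / t) ^ D := by
  -- `B` makes `C (s/2) y(s)^(1/D)` exceed `4^D` once `s y(s)^(1/D) > B`. Then `y(s/2) ≥ 4^D y(s)`,
  -- so halving `s` doubles `s y(s)^(1/D)`.
  set B : ℝ := 2 * 4 ^ D / C with hB
  have hB0 : 0 < B := by positivity
  have hD' : 0 < 1 / D := by positivity
  have hstep : ∀ s, 0 < s → B < s * y s ^ (1 / D) →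
      2 * (s * y s ^ (1 / D)) ≤ s / 2 * y (s / 2) ^ (1 / D) := by
    intro s hs hBs
    have hz := hy0 s hs.le
    have h1 := hy (s / 2) s (by positivity) (by linarith)
    have h2 : (4 : ℝ) ^ D ≤ 1 + C * (s - s / 2) * y s ^ (1 / D) := by
      have : C * B = 2 * 4 ^ D := by rw [hB]; field_simp
      nlinarith [mul_lt_mul_of_pos_left hBs hC]
    have h3 : y s * 4 ^ D ≤ y (s / 2) := (mul_le_mul_of_nonneg_left h2 hz).trans h1
    have h4 := Real.rpow_le_rpow (by positivity) h3 hD'.le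
    rw [Real.mul_rpow hz (by positivity), ← Real.rpow_mul (by norm_num), mul_one_div_cancel hD.ne',
      Real.rpow_one] at h4
    have h5 := mul_le_mul_of_nonneg_left h4 (by positivity : 0 ≤ s / 2)
    linarith
  have hm : t * y t ^ (1 / D) ≤ B := by
    by_contra! hlt
    -- Repeated halving makes the quantity grow like `2^n`, whereas `y ≤ 1` bounds it by `t`.
    have hind : ∀ n : ℕ, 2 ^ n * (t * y t ^ (1 / D)) ≤ t / 2 ^ n * y (t / 2 ^ n) ^ (1 / D) := by
      intro n
      induction n with
      | zero => simp
      | succ n ih =>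
        have h1 : B < t / 2 ^ n * y (t / 2 ^ n) ^ (1 / D) := by
          refine lt_of_lt_of_le (lt_of_lt_of_le hlt ?_) ih
          exact le_mul_of_one_le_left (hB0.trans hlt).le (one_le_pow₀ (by norm_num))
        have h2 := hstep _ (by positivity) h1
        rw [show t / 2 ^ n / 2 = t / 2 ^ (n + 1) by rw [pow_succ]; field_simp] at h2
        refine le_trans ?_ h2
        rw [pow_succ']
        linarith
    obtain ⟨n, hn⟩ := pow_unbounded_of_one_lt (t / B) (by norm_num : (1 : ℝ) < 2)
    have h1 : y (t / 2 ^ n) ^ (1 / D) ≤ 1 :=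
      Real.rpow_le_one (hy0 _ (by positivity)) (hy1 _ (by positivity)) hD'.le
    have h2 : t / 2 ^ n * y (t / 2 ^ n) ^ (1 / D) ≤ t :=
      (mul_le_of_le_one_right (by positivity) h1).trans
        (div_le_self ht.le (one_le_pow₀ (by norm_num)))
    have h3 := (hind n).trans h2
    rw [div_lt_iff₀ hB0] at hn
    have h4 : (2 : ℝ) ^ n * B ≤ 2 ^ n * (t * y t ^ (1 / D)) := by gcongr
    linarith
  have hz := hy0 t ht.le
  have h1 : y t ^ (1 / D) ≤ B / t := by rw [le_div_iff₀ ht]; linarith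
  calc y t = (y t ^ (1 / D)) ^ D := by
        rw [← Real.rpow_mul hz, one_div_mul_cancel hD.ne', Real.rpow_one]
    _ ≤ _ := Real.rpow_le_rpow (by positivity) h1 hD.le

/-- Discrete form of the differential inequality `dy/dt ≤ -C y`. -/
theorem le_exp_of_linear_decrease {y : ℝ → ℝ} {C t : ℝ} (hC : 0 < C) (ht : 0 < t)
    (hy : ∀ a b, 0 ≤ a → a < b → b ≤ t → y b * (1 + C * (b - a)) ≤ y a) :
    y t * Real.exp (C * t) ≤ y 0 := by
  -- Cut `[0, t]` into `n` equal steps; the products `(1 + Ct/n)^n` tend to `e^(Ct)`.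
  have hn : ∀ n : ℕ, n ≠ 0 → y t * (1 + C * t / n) ^ n ≤ y 0 := by
    intro n hn
    have hn' : (0 : ℝ) < n := by positivity
    have hind : ∀ k : ℕ, k ≤ n → y (t * k / n) * (1 + C * t / n) ^ k ≤ y 0 := by
      intro k
      induction k with
      | zero => simp
      | succ k ih =>
        intro hk
        have hk' : ((k + 1 : ℕ) : ℝ) ≤ n := by exact_mod_cast hk
        have h1 := hy (t * k / n) (t * (k + 1 : ℕ) / n) (by positivity)
          (by gcongr; linarith) (by rw [div_le_iff₀ hn']; gcongr)
        rw [show C * (t * (k + 1 : ℕ) / n - t * k / n) = C * t / n by push_cast; ring] at h1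
        refine le_trans ?_ (ih (by omega))
        rw [pow_succ', ← mul_assoc]
        exact mul_le_mul_of_nonneg_right h1 (by positivity)
    have := hind n le_rfl
    rwa [mul_div_assoc, div_self hn'.ne', mul_one] at this
  have hlim := (Real.tendsto_one_add_div_pow_exp (C * t)).const_mul (y t)
  exact le_of_tendsto hlim (eventually_atTop.2 ⟨1, fun n h => hn n (by omega)⟩)

/-- Discrete form of the differential inequality `dy/dt ≤ -C y min(1, y^(1/D))`. -/
theorem le_add_of_nash_decrease {y : ℝ → ℝ} {C D : ℝ} (hC : 0 < C) (hD : 0 < D)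
    (hy0 : ∀ t, 0 ≤ t → 0 ≤ y t)
    (hy : ∀ a b, 0 ≤ a → a < b → y b * (1 + C * (b - a) * min 1 (y b ^ (1 / D))) ≤ y a)
    {t : ℝ} (ht : 0 < t) :
    y t ≤ (4 * 4 ^ D / C / t) ^ D + Real.exp (-(C * t / 2)) * y 0 := by
  have hanti : ∀ a b, 0 ≤ a → a ≤ b → y b ≤ y a := by
    intro a b ha hab
    rcases hab.eq_or_lt with rfl | hab
    · rfl
    have hb := hy0 b (by linarith)
    refine le_trans (le_mul_of_one_le_right hb ?_) (hy a b ha hab)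
    have : 0 ≤ C * (b - a) * min 1 (y b ^ (1 / D)) :=
      mul_nonneg (mul_nonneg hC.le (by linarith)) (le_min zero_le_one (by positivity))
    linarith
  have hD' : 0 < 1 / D := by positivity
  have ht2 : 0 < t / 2 := by positivity
  have hE : 0 ≤ Real.exp (-(C * t / 2)) * y 0 := mul_nonneg (Real.exp_pos _).le (hy0 0 le_rfl)
  -- As `y` decreases, either it is at most `1` on `[t/2, t]`, the polynomial regime, or at least
  -- `1` on `[0, t/2]`, the exponential one.
  rcases le_total (y (t / 2)) 1 with h | h
  · have h1 := le_rpow_of_polynomial_decrease (y := fun s => y (t / 2 + s)) hC hD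
      (fun s hs => hy0 _ (by linarith)) (fun s hs => (hanti _ _ ht2.le (by linarith)).trans h)
      (fun a b ha hab => by
        have h2 := hy (t / 2 + a) (t / 2 + b) (by linarith) (by linarith)
        have h3 : y (t / 2 + b) ^ (1 / D) ≤ 1 := Real.rpow_le_one (hy0 _ (by linarith))
          ((hanti (t / 2) _ ht2.le (by linarith)).trans h) hD'.le
        rw [min_eq_right h3] at h2
        convert h2 using 4
        ring) ht2
    rw [add_halves, show 2 * 4 ^ D / C / (t / 2) = 4 * 4 ^ D / C / t by field_simp; ring] at h1
    linarith
  · have h1 := le_exp_of_linear_decrease (y := y) hC ht2 (fun a b ha hab hb => by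
      have h2 := hy a b ha hab
      have h3 : 1 ≤ y b ^ (1 / D) :=
        Real.one_le_rpow (h.trans (hanti _ _ (by linarith) hb)) hD'.le
      rwa [min_eq_left h3, mul_one] at h2)
    have h4 : y t ≤ y (t / 2) := hanti _ _ ht2.le (by linarith)
    have h5 : y (t / 2) ≤ Real.exp (-(C * t / 2)) * y 0 := by
      rw [Real.exp_neg, ← div_eq_inv_mul, le_div_iff₀ (Real.exp_pos _),
        show C * t / 2 = C * (t / 2) by ring]
      exact h1
    have h6 : 0 ≤ (4 * 4 ^ D / C / t) ^ D := by positivity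
    linarith

/-! ### Interpolation of `Lᵖ` norms -/

section Interpolation

variable {α : Type*} [MeasurableSpace α] {μ : Measure α}

/-- Log-convexity of the `Lᵖ` norms. -/
theorem eLpNorm_le_rpow_mul_rpow {f : α → ℝ} (hf : AEStronglyMeasurable f μ) {a b c x y : ℝ}
    (ha : 0 < a) (hb : 0 < b) (hc : 0 < c) (hx : 0 ≤ x) (hy : 0 ≤ y) (hxy : x + y = 1)
    (h : a * x + c * y = b) :
    eLpNorm f (ENNReal.ofReal b) μ ≤
      eLpNorm f (ENNReal.ofReal a) μ ^ (a * x / b) * eLpNorm f (ENNReal.ofReal c) μ ^ (c * y / b) := by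
  have key : ∀ e : ℝ, 0 < e → eLpNorm f (ENNReal.ofReal e) μ =
      (∫⁻ z, ‖f z‖ₑ ^ e ∂μ) ^ (1 / e) := by
    intro e he
    rw [eLpNorm_eq_lintegral_rpow_enorm_toReal (by simpa using he) ENNReal.ofReal_ne_top,
      ENNReal.toReal_ofReal he.le]
  rw [key a ha, key b hb, key c hc, ← ENNReal.rpow_mul, ← ENNReal.rpow_mul,
    show 1 / a * (a * x / b) = x * (1 / b) by field_simp,
    show 1 / c * (c * y / b) = y * (1 / b) by field_simp, ENNReal.rpow_mul, ENNReal.rpow_mul,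
    ← ENNReal.mul_rpow_of_nonneg _ _ (by positivity)]
  refine ENNReal.rpow_le_rpow ?_ (by positivity)
  refine le_trans (lintegral_mono fun z => ?_)
    (ENNReal.lintegral_mul_norm_pow_le (hf.enorm.pow_const a) (hf.enorm.pow_const c) hx hy hxy)
  rw [← ENNReal.rpow_mul, ← ENNReal.rpow_mul,
    ← ENNReal.rpow_add_of_nonneg _ _ (by positivity) (by positivity), h]

theorem eLpNorm_le_add_of_le_of_le {f : α → ℝ} (hf : AEStronglyMeasurable f μ) {a b c : ℝ}
    (ha : 0 < a) (hab : a ≤ b) (hbc : b ≤ c) :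
    eLpNorm f (ENNReal.ofReal b) μ ≤
      eLpNorm f (ENNReal.ofReal a) μ + eLpNorm f (ENNReal.ofReal c) μ := by
  rcases hab.eq_or_lt with rfl | hab
  · exact le_self_add
  have hac : 0 < c - a := by linarith
  have hb : 0 < b := by linarith
  have hx : 0 ≤ (c - b) / (c - a) := div_nonneg (by linarith) hac.le
  have hy : 0 ≤ (b - a) / (c - a) := div_nonneg (by linarith) hac.le
  have hsum : a * ((c - b) / (c - a)) + c * ((b - a) / (c - a)) = b := by field_simp; ring
  refine (eLpNorm_le_rpow_mul_rpow hf ha hb (by linarith) hx hy (by field_simp; ring) hsum).trans ?_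
  set A := eLpNorm f (ENNReal.ofReal a) μ
  set B := eLpNorm f (ENNReal.ofReal c) μ
  have hx' : 0 ≤ a * ((c - b) / (c - a)) / b := by positivity
  have hy' : 0 ≤ c * ((b - a) / (c - a)) / b := by
    have : 0 < c := by linarith
    positivity
  calc A ^ (a * ((c - b) / (c - a)) / b) * B ^ (c * ((b - a) / (c - a)) / b)
      ≤ (A + B) ^ (a * ((c - b) / (c - a)) / b) * (A + B) ^ (c * ((b - a) / (c - a)) / b) :=
        mul_le_mul' (ENNReal.rpow_le_rpow le_self_add hx') (ENNReal.rpow_le_rpow le_add_self hy')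
    _ = A + B := by
        rw [← ENNReal.rpow_add_of_nonneg _ _ hx' hy', ← add_div, hsum, div_self hb.ne',
          ENNReal.rpow_one]

end Interpolation

/-! ### Positivity of the semigroup -/

namespace SymmMarkovSemigroup

variable {α : Type*} [MeasurableSpace α] {μ : Measure α} (T : SymmMarkovSemigroup μ)

/-- By symmetry `∫_s T_t f = ⟨f, T_t 1_s⟩`, and `T_t 1_s ≥ 0` by the Markov property. -/
theorem op_nonneg (t : ℝ≥0) {f : Lp ℝ 2 μ} (hf : 0 ≤ f) : 0 ≤ T.op t f := by
  rw [← Lp.coeFn_nonneg] at hf ⊢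
  refine AEFinStronglyMeasurable.ae_nonneg_of_forall_setIntegral_nonneg ?_ ?_ ?_
  · exact (Lp.finStronglyMeasurable _ (by norm_num) (by norm_num)).aefinStronglyMeasurable
  · intro s hs hμs
    exact integrableOn_Lp_of_measure_ne_top _ fact_one_le_two_ennreal.elim hμs.ne
  · intro s hs hμs
    have h1 := T.markov t (indicatorConstLp 2 hs hμs.ne 1) (by
      filter_upwards [indicatorConstLp_coeFn (p := 2) (hs := hs) (hμs := hμs.ne) (c := (1 : ℝ))]
        with x hx
      rw [hx]
      by_cases h : x ∈ s <;> simp [h])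
    rw [← L2.inner_indicatorConstLp_one hs hμs.ne, ← T.symm, L2.inner_def]
    refine integral_nonneg_of_ae ?_
    filter_upwards [h1, hf] with x hx hfx
    simpa using mul_nonneg hfx hx.1

theorem op_mono (t : ℝ≥0) {f g : Lp ℝ 2 μ} (h : f ≤ g) : T.op t f ≤ T.op t g := by
  have := T.op_nonneg t (sub_nonneg.2 h)
  rwa [map_sub, sub_nonneg] at this

theorem abs_op_le (t : ℝ≥0) (f : Lp ℝ 2 μ) : |T.op t f| ≤ T.op t |f| := by
  refine abs_le'.2 ⟨T.op_mono t (le_abs_self f), ?_⟩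
  rw [← map_neg]
  exact T.op_mono t (neg_le_abs f)

/-- For `β > 0`, apply the Markov property to `f⁺ / β` and use `f ≤ f⁺`. Constants need not lie in
`L²`, so they cannot be subtracted inside `T_t`. -/
theorem op_le_const (t : ℝ≥0) {f : Lp ℝ 2 μ} {β : ℝ} (hβ : 0 ≤ β) (hf : ∀ᵐ x ∂μ, f x ≤ β) :
    ∀ᵐ x ∂μ, T.op t f x ≤ β := by
  rcases hβ.eq_or_lt with rfl | hβ
  · have h : f ≤ 0 := by
      rw [← Lp.coeFn_le]
      filter_upwards [hf, Lp.coeFn_zero ℝ 2 μ] with x hx h0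
      rwa [h0]
    have h2 := T.op_mono t h
    rw [map_zero, ← Lp.coeFn_le] at h2
    filter_upwards [h2, Lp.coeFn_zero ℝ 2 μ] with x hx h0
    rwa [h0] at hx
  have h1 := T.markov t (β⁻¹ • (f ⊔ 0)) (by
    filter_upwards [hf, Lp.coeFn_smul β⁻¹ (f ⊔ 0), Lp.coeFn_sup f 0, Lp.coeFn_zero ℝ 2 μ]
      with x hx h2 h3 h4
    rw [h2, Pi.smul_apply, h3, Pi.sup_apply, h4, smul_eq_mul]
    have h5 : f x ⊔ (0 : α → ℝ) x ≤ β := sup_le hx hβ.le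
    have h6 : 0 ≤ f x ⊔ (0 : α → ℝ) x := le_sup_right
    exact ⟨by positivity, by rw [inv_mul_le_iff₀ hβ]; linarith⟩)
  have h2 := T.op_mono t (le_sup_left : f ≤ f ⊔ 0)
  rw [← Lp.coeFn_le] at h2
  rw [map_smul] at h1
  filter_upwards [h1, h2, Lp.coeFn_smul β⁻¹ (T.op t (f ⊔ 0))] with x hx h3 h4
  rw [h4, Pi.smul_apply, smul_eq_mul, inv_mul_le_iff₀ hβ] at hx
  linarith [hx.2]

end SymmMarkovSemigroup

/-! ### Test functions and Jensen's inequality -/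

/-- The left side is the tangent at `a` to the convex function `y ↦ y^m`; the bound is weighted
AM-GM for `y^m` and `a^m`. -/
theorem tangent_le_rpow {a y m : ℝ} (ha : 0 ≤ a) (hy : 0 ≤ y) (hm : 1 ≤ m) :
    m * a ^ (m - 1) * y - (m - 1) * a ^ m ≤ y ^ m := by
  have hm0 : 0 < m := by linarith
  have hw : 0 ≤ 1 - 1 / m := by rw [sub_nonneg, div_le_one hm0]; exact hm
  have h := Real.geom_mean_le_arith_mean2_weighted (w₁ := 1 / m) (w₂ := 1 - 1 / m)
    (p₁ := y ^ m) (p₂ := a ^ m) (by positivity) hw (by positivity) (by positivity) (by ring)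
  rw [← Real.rpow_mul hy, mul_one_div_cancel hm0.ne', Real.rpow_one, ← Real.rpow_mul ha,
    show m * (1 - 1 / m) = m - 1 by field_simp] at h
  have h2 := mul_le_mul_of_nonneg_left h hm0.le
  have e : m * (1 / m * y ^ m + (1 - 1 / m) * a ^ m) = y ^ m + (m - 1) * a ^ m := by
    field_simp
  rw [e] at h2
  linarith

/-- Integrable and bounded nonnegative elements of `L²`. -/
structure IsTest {α : Type*} [MeasurableSpace α] {μ : Measure α} (f : Lp ℝ 2 μ) : Prop where
  nonneg : ∀ᵐ x ∂μ, 0 ≤ f x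
  memLp_one : MemLp f 1 μ
  bdd : ∃ M : ℝ, 0 < M ∧ ∀ᵐ x ∂μ, f x ≤ M

section

variable {α : Type*} [MeasurableSpace α] {μ : Measure α}

theorem IsTest.exists_of_le {f : Lp ℝ 2 μ} (hf : IsTest f) {φ : α → ℝ}
    (hφ : AEStronglyMeasurable φ μ) (h0 : ∀ᵐ x ∂μ, 0 ≤ φ x) {C : ℝ}
    (hC : ∀ᵐ x ∂μ, φ x ≤ C * f x) : ∃ g : Lp ℝ 2 μ, IsTest g ∧ g =ᵐ[μ] φ := by
  have hle : ∀ᵐ x ∂μ, ‖φ x‖ ≤ ‖C * f x‖ := by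
    filter_upwards [h0, hC] with x h1 h2
    rw [Real.norm_of_nonneg h1, Real.norm_of_nonneg (h1.trans h2)]
    exact h2
  have h2 : MemLp φ 2 μ := ((Lp.memLp f).const_mul C).mono hφ hle
  have h1 : MemLp φ 1 μ := (hf.memLp_one.const_mul C).mono hφ hle
  obtain ⟨M, hM, hfM⟩ := hf.bdd
  refine ⟨h2.toLp φ, ⟨?_, (memLp_congr_ae h2.coeFn_toLp).2 h1, |C| * M + 1, by positivity, ?_⟩,
    h2.coeFn_toLp⟩
  · filter_upwards [h2.coeFn_toLp, h0] with x hx h0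
    rwa [hx]
  · filter_upwards [h2.coeFn_toLp, hC, hfM, hf.nonneg] with x hx h3 h4 h5
    rw [hx]
    have h6 : C * f x ≤ |C| * f x := mul_le_mul_of_nonneg_right (le_abs_self C) h5
    have h7 : |C| * f x ≤ |C| * M := mul_le_mul_of_nonneg_left h4 (abs_nonneg C)
    linarith

theorem IsTest.exists_rpow {f : Lp ℝ 2 μ} (hf : IsTest f) {m : ℝ} (hm : 1 ≤ m) :
    ∃ g : Lp ℝ 2 μ, IsTest g ∧ g =ᵐ[μ] fun x => f x ^ m := by
  obtain ⟨M, hM, hfM⟩ := hf.bdd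
  refine hf.exists_of_le (C := M ^ (m - 1)) ?_ ?_ ?_
  · exact ((Lp.aestronglyMeasurable f).aemeasurable.pow_const m).aestronglyMeasurable
  · filter_upwards [hf.nonneg] with x hx using Real.rpow_nonneg hx m
  · filter_upwards [hf.nonneg, hfM] with x hx hx2
    rcases hx.eq_or_lt with h | h
    · rw [← h, Real.zero_rpow (by linarith), mul_zero]
    · have : f x ^ m = f x ^ (m - 1) * f x := by
        rw [← Real.rpow_add_one h.ne', sub_add_cancel]
      rw [this]
      exact mul_le_mul_of_nonneg_right (Real.rpow_le_rpow hx hx2 (by linarith)) hx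

namespace SymmMarkovSemigroup

variable (T : SymmMarkovSemigroup μ)

theorem op_isTest (t : ℝ≥0) {f : Lp ℝ 2 μ} (hf : IsTest f) : IsTest (T.op t f) := by
  obtain ⟨M, hM, hfM⟩ := hf.bdd
  refine ⟨?_, ⟨Lp.aestronglyMeasurable _, (T.eLpNorm_one_op_le t f hf.memLp_one).trans_lt
    hf.memLp_one.2⟩, M, hM, T.op_le_const t hM.le hfM⟩
  exact (Lp.coeFn_nonneg _).2 (T.op_nonneg t ((Lp.coeFn_nonneg f).1 hf.nonneg))

/-- Jensen's inequality for sub-Markov operators. -/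
theorem op_rpow_le (t : ℝ≥0) {f g : Lp ℝ 2 μ} (hf : ∀ᵐ x ∂μ, 0 ≤ f x) {m : ℝ} (hm : 1 ≤ m)
    (hg : g =ᵐ[μ] fun x => f x ^ m) : ∀ᵐ x ∂μ, T.op t f x ^ m ≤ T.op t g x := by
  have hTf : ∀ᵐ x ∂μ, 0 ≤ T.op t f x :=
    (Lp.coeFn_nonneg _).2 (T.op_nonneg t ((Lp.coeFn_nonneg f).1 hf))
  -- The power is the supremum of its tangents. Rational base points keep the union of exceptional
  -- sets null. The constant term `(m - 1)|a|^m` is nonnegative, so sub-Markov suffices.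
  have key : ∀ᵐ x ∂μ, ∀ a : ℚ,
      m * |(a : ℝ)| ^ (m - 1) * T.op t f x - (m - 1) * |(a : ℝ)| ^ m ≤ T.op t g x := by
    rw [ae_all_iff]
    intro a
    have h1 := T.op_le_const t (f := (m * |(a : ℝ)| ^ (m - 1)) • f - g)
      (β := (m - 1) * |(a : ℝ)| ^ m) (mul_nonneg (by linarith) (by positivity)) (by
        filter_upwards [hf, hg, Lp.coeFn_sub ((m * |(a : ℝ)| ^ (m - 1)) • f) g,
          Lp.coeFn_smul (m * |(a : ℝ)| ^ (m - 1)) f] with x h1 h2 h3 h4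
        rw [h3, Pi.sub_apply, h4, Pi.smul_apply, smul_eq_mul, h2]
        linarith [tangent_le_rpow (abs_nonneg (a : ℝ)) h1 hm])
    rw [map_sub, map_smul] at h1
    filter_upwards [h1, Lp.coeFn_sub ((m * |(a : ℝ)| ^ (m - 1)) • T.op t f) (T.op t g),
      Lp.coeFn_smul (m * |(a : ℝ)| ^ (m - 1)) (T.op t f)] with x h1 h3 h4
    rw [h3, Pi.sub_apply, h4, Pi.smul_apply, smul_eq_mul] at h1
    linarith
  filter_upwards [key, hTf] with x hx hy
  set y := T.op t f x
  have hcl : IsClosed {a : ℝ | m * |a| ^ (m - 1) * y - (m - 1) * |a| ^ m ≤ T.op t g x} := by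
    refine isClosed_le ?_ continuous_const
    have h1 : Continuous fun a : ℝ => |a| ^ (m - 1) :=
      continuous_abs.rpow_const fun _ => Or.inr (by linarith)
    have h2 : Continuous fun a : ℝ => |a| ^ m :=
      continuous_abs.rpow_const fun _ => Or.inr (by linarith)
    fun_prop
  -- By density the base point may be `y = T_t f x` itself, where the tangent touches the power.
  have h := hcl.closure_subset_iff.2 (Set.range_subset_iff.2 hx) (Rat.denseRange_cast y)
  have h' : m * |y| ^ (m - 1) * y - (m - 1) * |y| ^ m ≤ T.op t g x := h
  rw [abs_of_nonneg hy] at h'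
  rcases hy.eq_or_lt with h0 | h0
  · rw [← h0, Real.zero_rpow (by linarith : m ≠ 0)] at h' ⊢
    linarith
  · have e : y ^ m = y ^ (m - 1) * y := by rw [← Real.rpow_add_one h0.ne', sub_add_cancel]
    rw [e] at h' ⊢
    linarith

end SymmMarkovSemigroup

end

/-! ### Energy decay along the semigroup -/

namespace SymmMarkovSemigroup

variable {α : Type*} [MeasurableSpace α] {μ : Measure α} (T : SymmMarkovSemigroup μ)

theorem op_add_apply (s t : ℝ≥0) (v : Lp ℝ 2 μ) : T.op (s + t) v = T.op s (T.op t v) := by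
  rw [T.op_add]; rfl

theorem inner_op_op (s t : ℝ≥0) (v : Lp ℝ 2 μ) :
    ⟪T.op s v, T.op t v⟫_ℝ = ⟪T.op (s + t) v, v⟫_ℝ := by
  rw [← T.symm, ← T.op_add_apply, add_comm]

theorem inner_op_self (t : ℝ≥0) (v : Lp ℝ 2 μ) : ⟪T.op t v, v⟫_ℝ = ‖T.op (t / 2) v‖ ^ 2 := by
  rw [← real_inner_self_eq_norm_sq, T.inner_op_op, add_halves]

/-- The function `t ↦ ⟨T_t v, v⟩` is convex. -/
theorem convexOn_inner_op (v : Lp ℝ 2 μ) :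
    ConvexOn ℝ (Set.Ici 0) fun x : ℝ => ⟪T.op x.toNNReal v, v⟫_ℝ := by
  refine convexOn_of_continuousOn_of_midpoint (convex_Ici 0) ?_ ?_
  · refine Continuous.continuousOn ?_
    exact ((T.continuous_op v).comp continuous_real_toNNReal).inner continuous_const
  · intro x hx y hy
    have hx' : 0 ≤ x := hx
    have hy' : 0 ≤ y := hy
    have e : ((x + y) / 2).toNNReal = x.toNNReal / 2 + y.toNNReal / 2 := by
      rw [← add_div, ← Real.toNNReal_add hx' hy', Real.toNNReal_div (by positivity)]
      simp
    -- Expanding `‖T_{x/2} v - T_{y/2} v‖² ≥ 0` gives midpoint convexity without the spectral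
    -- theorem.
    have h : 0 ≤ ⟪T.op (x.toNNReal / 2) v - T.op (y.toNNReal / 2) v,
        T.op (x.toNNReal / 2) v - T.op (y.toNNReal / 2) v⟫_ℝ := real_inner_self_nonneg
    rw [inner_sub_left, inner_sub_right, inner_sub_right, T.inner_op_op, T.inner_op_op,
      T.inner_op_op, T.inner_op_op, add_halves, add_halves, add_comm (y.toNNReal / 2), ← e] at h
    linarith

/-- For `t > 0` the function `T_t v` lies in the form domain, and the form controls the decrease
of `s ↦ ⟨T_s v, v⟩` up to time `2 t`. -/
theorem op_mem_formDomain (v : Lp ℝ 2 μ) {t : ℝ≥0} (ht : 0 < t) :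
    T.op t v ∈ T.formDomain ∧ ∀ a : ℝ≥0, a < 2 * t →
      ((2 * t : ℝ≥0) - a : ℝ) * T.form (T.op t v) (T.op t v) ≤
        ⟪T.op a v, v⟫_ℝ - ⟪T.op (2 * t) v, v⟫_ℝ := by
  set g : ℝ → ℝ := fun x => ⟪T.op x.toNNReal v, v⟫_ℝ with hg
  have hconv := T.convexOn_inner_op v
  have ht' : (0 : ℝ) < (2 * t : ℝ≥0) := by exact_mod_cast (by positivity : 0 < 2 * t)
  have hint : ((2 * t : ℝ≥0) : ℝ) ∈ interior (Set.Ici (0 : ℝ)) := by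
    rw [interior_Ici]; exact ht'
  have hder := hconv.hasDerivWithinAt_rightDeriv_of_mem_interior hint
  set g' := derivWithin g (Set.Ioi ((2 * t : ℝ≥0) : ℝ)) ((2 * t : ℝ≥0) : ℝ) with hg'
  have hgv : ∀ s : ℝ≥0, g s = ⟪T.op s v, v⟫_ℝ := fun s => by simp [hg]
  -- The approximating form at `T_t v` is minus a difference quotient of `g` from `2t` to `2t + h`.
  -- One-sided differentiability of convex functions supplies the limit.
  have hlim : Tendsto (fun h : ℝ≥0 => T.approxForm h (T.op t v) (T.op t v)) (𝓝[>] 0)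
      (𝓝 (-g')) := by
    have h1 := (hasDerivWithinAt_iff_tendsto_slope' Set.self_notMem_Ioi).1 hder
    have h2 : Tendsto (fun h : ℝ≥0 => ((2 * t + h : ℝ≥0) : ℝ)) (𝓝[>] 0)
        (𝓝[>] ((2 * t : ℝ≥0) : ℝ)) := by
      refine tendsto_nhdsWithin_iff.2 ⟨?_, ?_⟩
      · have h3 : Continuous fun h : ℝ≥0 => ((2 * t + h : ℝ≥0) : ℝ) := by fun_prop
        have h4 := h3.tendsto 0
        rw [add_zero] at h4
        exact h4.mono_left nhdsWithin_le_nhds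
      · filter_upwards [self_mem_nhdsWithin] with h hh
        have hh' : 0 < h := hh
        rw [Set.mem_Ioi]
        exact_mod_cast lt_add_of_pos_right _ hh'
    refine ((h1.comp h2).neg).congr fun h => ?_
    simp only [Function.comp_apply, slope_def_field]
    rw [Real.toNNReal_coe, Real.toNNReal_coe, approxForm, inner_sub_left, ← T.op_add_apply, T.inner_op_op, T.inner_op_op,
      show h + t + t = 2 * t + h by ring, show t + t = 2 * t by ring,
      show ((2 * t + h : ℝ≥0) : ℝ) - ((2 * t : ℝ≥0) : ℝ) = h by push_cast; ring]
    ring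
  refine ⟨⟨_, hlim⟩, fun a ha => ?_⟩
  have hform : T.form (T.op t v) (T.op t v) = -g' := hlim.limUnder_eq
  have ha' : (a : ℝ) < (2 * t : ℝ≥0) := by exact_mod_cast ha
  have hs : slope g (a : ℝ) ((2 * t : ℝ≥0) : ℝ) ≤ g' := by
    refine le_trans ?_ (hconv.leftDeriv_le_rightDeriv_of_mem_interior hint)
    exact hconv.slope_le_leftDeriv_of_mem_interior (Set.mem_Ici.2 a.2) hint ha'
  rw [slope_def_field, div_le_iff₀ (by linarith), hgv, hgv] at hs
  rw [hform]
  linarith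

/-! ### The Nash inequality and the `L¹ → L²` estimate -/

/-- A Nash type inequality for the form, with `L¹` norm on the right. -/
def HasNashInequality (C D : ℝ) : Prop :=
  ∀ f ∈ T.formDomain, ∀ K : ℝ, 0 < K → eLpNorm f 1 μ ≤ ENNReal.ofReal K →
    C * ‖f‖ ^ 2 * min 1 ((‖f‖ ^ 2 / K ^ 2) ^ (1 / D)) ≤ T.form f f

variable {T}

/-- Since `T_s` contracts `L¹`, the same `K` serves in the Nash inequality at every time, which
closes the differential inequality for `⟨T_s f, f⟩ / K²`. -/
theorem HasNashInequality.norm_op_le {C D : ℝ} (hT : T.HasNashInequality C D) (hC : 0 < C)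
    (hD : 0 < D) {t : ℝ≥0} (ht : 0 < t) (f : Lp ℝ 2 μ) {K : ℝ} (hK : 0 < K)
    (hf : eLpNorm f 1 μ ≤ ENNReal.ofReal K) :
    ‖T.op t f‖ ≤ (2 * 4 ^ D / C / t) ^ (D / 2) * K + Real.exp (-(C * t / 2)) * ‖f‖ := by
  have hf1 : MemLp f 1 μ := ⟨Lp.aestronglyMeasurable f, hf.trans_lt ENNReal.ofReal_lt_top⟩
  have ht' : (0 : ℝ) < t := by exact_mod_cast ht
  have hnn : ∀ s : ℝ≥0, 0 ≤ ⟪T.op s f, f⟫_ℝ := fun s => by rw [T.inner_op_self]; positivity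
  -- Evaluated at time `2t`, because `⟨T_{2t} f, f⟩ = ‖T_t f‖²`.
  have h := le_add_of_nash_decrease (y := fun x => ⟪T.op x.toNNReal f, f⟫_ℝ / K ^ 2) hC hD
    (fun s _ => div_nonneg (hnn _) (by positivity)) (fun a b ha hab => by
      lift a to ℝ≥0 using ha
      lift b to ℝ≥0 using by linarith [a.2]
      have hab' : a < b := by exact_mod_cast hab
      have hb : 0 < b / 2 := by have := (zero_le : 0 ≤ a).trans_lt hab'; positivity
      obtain ⟨h1, h2⟩ := T.op_mem_formDomain f hb
      have h3 := hT _ h1 K hK ((T.eLpNorm_one_op_le _ f hf1).trans hf)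
      have h4 := h2 a (by rwa [mul_div_cancel₀ _ two_ne_zero])
      rw [mul_div_cancel₀ _ two_ne_zero] at h4
      rw [← T.inner_op_self] at h3
      simp only [Real.toNNReal_coe]
      have h5 := mul_le_mul_of_nonneg_left h3 (sub_nonneg.2 hab.le)
      have h6 := h5.trans h4
      rw [div_mul_eq_mul_div]
      refine div_le_div_of_nonneg_right ?_ (by positivity)
      linarith) (t := 2 * t) (by positivity)
  simp only [Real.toNNReal_zero, T.op_zero, ContinuousLinearMap.id_apply] at h
  have e1 : (2 * (t : ℝ)).toNNReal = 2 * t := by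
    rw [Real.toNNReal_mul (by norm_num), Real.toNNReal_coe]; simp
  rw [e1, T.inner_op_self, mul_div_cancel_left₀ _ two_ne_zero, real_inner_self_eq_norm_sq,
    div_le_iff₀ (by positivity)] at h
  set B : ℝ := 2 * 4 ^ D / C / t with hB
  have e2 : 4 * 4 ^ D / C / (2 * (t : ℝ)) = B := by rw [hB]; field_simp; norm_num
  have e3 : B ^ D = (B ^ (D / 2)) ^ 2 := by
    rw [← Real.rpow_natCast, ← Real.rpow_mul (by positivity)]; congr 1; push_cast; ring
  have e4 : Real.exp (-(C * (2 * t) / 2)) = Real.exp (-(C * t / 2)) ^ 2 := by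
    rw [← Real.exp_nat_mul]; congr 1; push_cast; ring
  rw [e2, e3, e4] at h
  have hB0 : 0 ≤ B ^ (D / 2) := by positivity
  have hE0 := (Real.exp_pos (-(C * t / 2))).le
  refine abs_le_of_sq_le_sq' ?_ (by positivity) |>.2
  have e5 : ((B ^ (D / 2)) ^ 2 + Real.exp (-(C * t / 2)) ^ 2 * (‖f‖ ^ 2 / K ^ 2)) * K ^ 2 =
      (B ^ (D / 2) * K) ^ 2 + (Real.exp (-(C * t / 2)) * ‖f‖) ^ 2 := by
    field_simp
  rw [e5] at h
  have h7 : 0 ≤ B ^ (D / 2) * K * (Real.exp (-(C * t / 2)) * ‖f‖) := by positivity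
  nlinarith

theorem approxForm_smul (T : SymmMarkovSemigroup μ) (c : ℝ) (t : ℝ≥0) (f : Lp ℝ 2 μ) :
    T.approxForm t (c • f) (c • f) = c ^ 2 * T.approxForm t f f := by
  rw [approxForm, approxForm, map_smul, ← smul_sub, real_inner_smul_left, real_inner_smul_right]
  ring

theorem tendsto_approxForm {f : Lp ℝ 2 μ} (hf : f ∈ T.formDomain) :
    Tendsto (fun t : ℝ≥0 => T.approxForm t f f) (𝓝[>] 0) (𝓝 (T.form f f)) := by
  obtain ⟨l, hl⟩ := hf
  rwa [form, hl.limUnder_eq]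

/-- Normalise `f` by `c = ‖f‖_r`. Interpolation gives `c ≤ K^((2-r)/r) ‖f‖₂^(2(r-1)/r)`, so `‖f‖₂ /
c ≥ (‖f‖₂ / K)^((2-r)/r)`; raising this to the power `2/d` produces the exponent `1/D`. -/
theorem hasNashInequality_of_norm_eq_one {r d C₁ : ℝ} (hr₁ : 1 ≤ r) (hr₂ : r < 2) (hd : 0 < d)
    (hC₁ : 0 < C₁)
    (hNash : ∀ f : Lp ℝ 2 μ, f ∈ T.formDomain → MemLp f 1 μ →
      eLpNorm f (ENNReal.ofReal r) μ = 1 →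
      C₁ * ‖f‖ ^ 2 * min 1 (‖f‖ ^ (2 / d)) ≤ T.form f f) :
    T.HasNashInequality C₁ (d * r / (2 - r)) := by
  intro f hf K hK hfK
  have hr0 : 0 < r := by linarith
  have hf1 : MemLp f 1 μ := ⟨Lp.aestronglyMeasurable f, hfK.trans_lt ENNReal.ofReal_lt_top⟩
  have hlim := tendsto_approxForm hf
  rcases eq_or_ne f 0 with h0 | h0
  · have h1 : T.form f f = 0 := by
      refine tendsto_nhds_unique hlim ?_
      simp [h0, approxForm]
    simp [h0] at h1 ⊢
    exact h1.ge
  have hn : 0 < ‖f‖ := norm_pos_iff.2 h0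
  have hint := eLpNorm_le_rpow_mul_rpow (Lp.aestronglyMeasurable f) (a := 1) (b := r) (c := 2)
    (x := 2 - r) (y := r - 1) one_pos hr0 two_pos (by linarith) (by linarith) (by ring) (by ring)
  rw [ENNReal.ofReal_one, ENNReal.ofReal_ofNat] at hint
  have hf2 : eLpNorm f 2 μ = ENNReal.ofReal ‖f‖ := by
    rw [Lp.norm_def, ENNReal.ofReal_toReal (Lp.eLpNorm_ne_top f)]
  set R : ℝ := K ^ (1 * (2 - r) / r) * ‖f‖ ^ (2 * (r - 1) / r) with hR
  have hbound : eLpNorm f (ENNReal.ofReal r) μ ≤ ENNReal.ofReal R := by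
    refine hint.trans ?_
    rw [hR, ENNReal.ofReal_mul (by positivity), ← ENNReal.ofReal_rpow_of_pos hK,
      ← ENNReal.ofReal_rpow_of_pos hn, hf2]
    have : 0 ≤ 1 * (2 - r) / r := div_nonneg (by linarith) hr0.le
    gcongr
  set c := (eLpNorm f (ENNReal.ofReal r) μ).toReal with hc
  have hfin : eLpNorm f (ENNReal.ofReal r) μ ≠ ∞ := (hbound.trans_lt ENNReal.ofReal_lt_top).ne
  have hc0 : 0 < c := by
    refine ENNReal.toReal_pos ?_ hfin
    rw [Ne, eLpNorm_eq_zero_iff (Lp.aestronglyMeasurable f) (by simpa using hr0)]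
    intro h
    exact h0 ((Lp.eq_zero_iff_ae_eq_zero).2 h)
  have hcR : c ≤ R := ENNReal.toReal_le_of_le_ofReal (by positivity) hbound
  have hg := hlim.const_mul (c⁻¹ ^ 2)
  simp_rw [← approxForm_smul] at hg
  have hgn : eLpNorm (c⁻¹ • f : Lp ℝ 2 μ) (ENNReal.ofReal r) μ = 1 := by
    rw [eLpNorm_congr_ae (Lp.coeFn_smul c⁻¹ f), eLpNorm_const_smul,
      Real.enorm_of_nonneg (by positivity), ← ENNReal.ofReal_toReal hfin, ← hc,
      ← ENNReal.ofReal_mul (by positivity), inv_mul_cancel₀ hc0.ne', ENNReal.ofReal_one]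
  have h := hNash (c⁻¹ • f) ⟨_, hg⟩
    ((memLp_congr_ae (Lp.coeFn_smul c⁻¹ f)).2 (hf1.const_smul c⁻¹)) hgn
  rw [show T.form (c⁻¹ • f) (c⁻¹ • f) = _ from hg.limUnder_eq, norm_smul,
    Real.norm_of_nonneg (by positivity), mul_pow] at h
  have h2 : C₁ * ‖f‖ ^ 2 * min 1 ((c⁻¹ * ‖f‖) ^ (2 / d)) ≤ T.form f f := by
    have h3 := mul_le_mul_of_nonneg_left h (sq_nonneg c)
    have e1 : c ^ 2 * (C₁ * (c⁻¹ ^ 2 * ‖f‖ ^ 2) * min 1 ((c⁻¹ * ‖f‖) ^ (2 / d))) =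
        C₁ * ‖f‖ ^ 2 * min 1 ((c⁻¹ * ‖f‖) ^ (2 / d)) := by field_simp
    have e2 : c ^ 2 * (c⁻¹ ^ 2 * T.form f f) = T.form f f := by field_simp
    rwa [e1, e2] at h3
  refine le_trans ?_ h2
  refine mul_le_mul_of_nonneg_left (min_le_min le_rfl ?_) (by positivity)
  have hR0 : 0 < R := by positivity
  have e : (‖f‖ ^ 2 / K ^ 2) ^ (1 / (d * r / (2 - r))) = (R⁻¹ * ‖f‖) ^ (2 / d) := by
    have h2r : 0 < 2 - r := by linarith
    have e1 : R⁻¹ * ‖f‖ = (‖f‖ / K) ^ ((2 - r) / r) := by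
      rw [hR, Real.div_rpow hn.le hK.le, one_mul]
      have e2 : ‖f‖ = ‖f‖ ^ ((2 - r) / r) * ‖f‖ ^ (2 * (r - 1) / r) := by
        rw [← Real.rpow_add hn, ← add_div, show (2 - r + 2 * (r - 1)) / r = 1 by field_simp; ring,
          Real.rpow_one]
      have h3 : 0 < K ^ ((2 - r) / r) := by positivity
      have h4 : 0 < ‖f‖ ^ (2 * (r - 1) / r) := by positivity
      rw [eq_div_iff h3.ne', inv_mul_eq_div, div_mul_eq_mul_div, div_eq_iff (by positivity)]
      linear_combination K ^ ((2 - r) / r) * e2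
    rw [e1, ← div_pow, ← Real.rpow_natCast, ← Real.rpow_mul (by positivity),
      ← Real.rpow_mul (by positivity)]
    congr 1
    push_cast
    field_simp
  rw [e]
  refine Real.rpow_le_rpow (by positivity) ?_ (by positivity)
  gcongr

end SymmMarkovSemigroup

/-! ### Duality: from `L¹ → L²` to `L¹ → Lˢ` for `1 < s ≤ 2` -/

section

variable {α : Type*} [MeasurableSpace α] {μ : Measure α}

theorem real_inner_eq_mul (x y : ℝ) : ⟪x, y⟫_ℝ = x * y := by simp [mul_comm]

namespace IsTest

theorem integrable {f : Lp ℝ 2 μ} (hf : IsTest f) : Integrable f μ :=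
  memLp_one_iff_integrable.1 hf.memLp_one

theorem integrable_rpow {f : Lp ℝ 2 μ} (hf : IsTest f) {p : ℝ} (hp : 1 ≤ p) :
    Integrable (fun x => f x ^ p) μ := by
  obtain ⟨g, hg, hgf⟩ := hf.exists_rpow hp
  exact hg.integrable.congr hgf

theorem eLpNorm_eq {f : Lp ℝ 2 μ} (hf : IsTest f) {p : ℝ} (hp : 1 ≤ p) :
    eLpNorm f (ENNReal.ofReal p) μ = ENNReal.ofReal ((∫ x, f x ^ p ∂μ) ^ (1 / p)) := by
  have hp0 : 0 < p := by linarith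
  have hnn : 0 ≤ᵐ[μ] fun x => f x ^ p := by
    filter_upwards [hf.nonneg] with x hx using Real.rpow_nonneg hx p
  rw [eLpNorm_eq_lintegral_rpow_enorm_toReal (by simpa using hp0) ENNReal.ofReal_ne_top,
    ENNReal.toReal_ofReal hp0.le,
    ← ENNReal.ofReal_rpow_of_nonneg (integral_nonneg_of_ae hnn) (by positivity),
    ofReal_integral_eq_lintegral_ofReal (hf.integrable_rpow hp) hnn]
  congr 1
  refine lintegral_congr_ae ?_
  filter_upwards [hf.nonneg] with x hx
  rw [Real.enorm_of_nonneg hx, ENNReal.ofReal_rpow_of_nonneg hx hp0.le]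

theorem eLpNorm_one_eq {f : Lp ℝ 2 μ} (hf : IsTest f) :
    eLpNorm f 1 μ = ENNReal.ofReal (∫ x, f x ∂μ) := by
  simpa using hf.eLpNorm_eq le_rfl

theorem norm_sq_eq (f : Lp ℝ 2 μ) : ‖f‖ ^ 2 = ∫ x, f x ^ 2 ∂μ := by
  rw [← real_inner_self_eq_norm_sq, L2.inner_def]
  simp [pow_two]

end IsTest

namespace SymmMarkovSemigroup

variable {T : SymmMarkovSemigroup μ}

/-- Let `K` decrease to `∫ f`; the value `K = ∫ f` itself is unavailable when `f = 0`. -/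
theorem HasNashInequality.norm_op_test_le {C D : ℝ} (hT : T.HasNashInequality C D) (hC : 0 < C)
    (hD : 0 < D) {t : ℝ≥0} (ht : 0 < t) {f : Lp ℝ 2 μ} (hf : IsTest f) :
    ‖T.op t f‖ ≤ (2 * 4 ^ D / C / t) ^ (D / 2) * ∫ x, f x ∂μ
      + Real.exp (-(C * t / 2)) * ‖f‖ := by
  have ht' : (0 : ℝ) < t := by exact_mod_cast ht
  have ha : 0 < (2 * 4 ^ D / C / (t : ℝ)) ^ (D / 2) := by positivity
  have hI : 0 ≤ ∫ x, f x ∂μ := integral_nonneg_of_ae hf.nonneg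
  refine le_of_forall_pos_le_add fun ε hε => ?_
  have h := hT.norm_op_le hC hD ht f
    (K := (∫ x, f x ∂μ) + ε / (2 * 4 ^ D / C / (t : ℝ)) ^ (D / 2)) (by positivity)
    (by rw [hf.eLpNorm_one_eq]; exact ENNReal.ofReal_le_ofReal (by linarith [div_pos hε ha]))
  rw [mul_add, mul_div_cancel₀ _ ha.ne'] at h
  linarith

/-- Up to an exponentially small error in `L²`, the operators `T_t` map `L²` to `L^∞`. -/
theorem HasNashInequality.exists_op_le_const_add {C D : ℝ} (hT : T.HasNashInequality C D)
    (hC : 0 < C) (hD : 0 < D) {t : ℝ≥0} (ht : 0 < t) {w : Lp ℝ 2 μ} (hw : IsTest w) :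
    ∃ k : Lp ℝ 2 μ, IsTest k ∧
      (∀ᵐ x ∂μ, T.op t w x ≤ (2 * 4 ^ D / C / t) ^ (D / 2) * ‖w‖ + k x) ∧
      ‖k‖ ≤ Real.exp (-(C * t / 2)) * ‖w‖ := by
  have ht' : (0 : ℝ) < t := by exact_mod_cast ht
  set a := (2 * 4 ^ D / C / (t : ℝ)) ^ (D / 2) with ha
  have ha0 : 0 < a := by positivity
  -- The remainder is `k = (T_t w - l)⁺`. In `‖k‖² = ⟨w, T_t k⟩ - l ∫ k` this level exactly cancels
  -- the term `a ‖w‖ ∫ k` of the `L¹ → L²` bound, leaving `e^(-Ct/2) ‖w‖ ‖k‖`.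
  set l := a * ‖w‖ with hl
  have hl0 : 0 ≤ l := by positivity
  have hTw := T.op_isTest t hw
  obtain ⟨k, hk, hkx⟩ := hTw.exists_of_le (φ := fun x => max (T.op t w x - l) 0) (C := 1)
    (((Lp.aestronglyMeasurable _).sub aestronglyMeasurable_const).sup aestronglyMeasurable_const)
    (Eventually.of_forall fun x => le_max_right _ _)
    (by filter_upwards [hTw.nonneg] with x hx; rw [one_mul]; exact max_le (by linarith) hx)
  refine ⟨k, hk, ?_, ?_⟩
  · filter_upwards [hkx] with x hx
    rw [hx]
    linarith [le_max_left (T.op t w x - l) 0]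
  · have h1 : ‖k‖ ^ 2 = ⟪T.op t k, w⟫_ℝ - l * ∫ x, k x ∂μ := by
      rw [T.symm, L2.inner_def, ← integral_const_mul,
        ← integral_sub (L2.integrable_inner _ _) (hk.integrable.const_mul l), IsTest.norm_sq_eq]
      refine integral_congr_ae ?_
      filter_upwards [hkx] with x hx
      simp only [real_inner_eq_mul, hx]
      rcases le_total (T.op t w x - l) 0 with h | h
      · simp [max_eq_right h]
      · rw [max_eq_left h]; ring
    have h2 := hT.norm_op_test_le hC hD ht hk
    have h3 := real_inner_le_norm (T.op t k) w
    have h4 := mul_le_mul_of_nonneg_right h2 (norm_nonneg w)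
    have h5 : ‖k‖ * ‖k‖ ≤ Real.exp (-(C * t / 2)) * ‖w‖ * ‖k‖ := by
      rw [← pow_two, h1]
      rw [← ha] at h4
      calc _ ≤ (a * ∫ x, k x ∂μ + Real.exp (-(C * t / 2)) * ‖k‖) * ‖w‖ - l * ∫ x, k x ∂μ := by
            linarith
        _ = _ := by rw [hl]; ring
    rcases (norm_nonneg k).eq_or_lt with h | h
    · rw [← h]; positivity
    · exact le_of_mul_le_mul_right h5 h

/-- Write `∫ w^s = ⟨w^(s-1), T_t v⟩ = ⟨T_t w^(s-1), v⟩` and bound `T_t w^(s-1)` by a constant plus a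
small function in `L^(s')`. The constant meets `‖v‖₁`, the small part `‖v‖_s`. -/
theorem HasNashInequality.integral_truncation_le {C D s ε : ℝ} (hT : T.HasNashInequality C D)
    (hC : 0 < C) (hD : 0 < D) (hs : 1 < s) (hs2 : s ≤ 2) (hε : 0 < ε) {t : ℝ≥0} (ht : 0 < t)
    {v w : Lp ℝ 2 μ} (hv : IsTest v) (hw : IsTest w)
    (hwv : w =ᵐ[μ] fun x => if ε < T.op t v x then T.op t v x else 0) :
    (∫ x, w x ^ s ∂μ) ^ (1 / s) ≤
      ((2 * 4 ^ D / C / t) ^ (D / 2)) ^ (2 * (s - 1) / s) * ∫ x, v x ∂μ +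
      Real.exp (-(C * t / 2)) ^ (2 * (s - 1) / s) * (∫ x, v x ^ s ∂μ) ^ (1 / s) := by
  have ht' : (0 : ℝ) < t := by exact_mod_cast ht
  have hs0 : 0 < s := by linarith
  have hs1 : 0 < s - 1 := by linarith
  set a := (2 * 4 ^ D / C / (t : ℝ)) ^ (D / 2) with ha
  have ha0 : 0 < a := by positivity
  set e := Real.exp (-(C * t / 2)) with he
  have he0 : 0 < e := Real.exp_pos _
  -- With this `m`, `2/m` is the conjugate exponent of `s`, so `φ = w^((s-1)/m)` has `‖φ‖₂² = ∫
  -- w^s`. Also `m ≤ 1`, which permits Jensen with exponent `1/m`.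
  set m := 2 * (s - 1) / s with hm
  have hm0 : 0 < m := by positivity
  have hm1 : m ≤ 1 := by rw [hm, div_le_one hs0]; linarith
  -- Below power one, `w^(s-1)` might fail to be integrable where `w` is small; the cut-off at `ε`
  -- gives `w^(s-1) ≤ ε^(s-2) T_t v`.
  have hu := T.op_isTest t hv
  obtain ⟨f, hf, hfx⟩ := hu.exists_of_le (φ := fun x => w x ^ (s - 1)) (C := ε ^ (s - 2))
    ((Lp.aestronglyMeasurable w).aemeasurable.pow_const _).aestronglyMeasurable
    (by filter_upwards [hw.nonneg] with x hx using Real.rpow_nonneg hx _)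
    (by
      filter_upwards [hwv, hu.nonneg] with x hx hu0
      rw [hx]
      split_ifs with h
      · have h1 : 0 < T.op t v x := hε.trans h
        rw [show s - 1 = s - 2 + 1 by ring, Real.rpow_add_one h1.ne']
        exact mul_le_mul_of_nonneg_right
          (Real.rpow_le_rpow_of_nonpos hε h.le (by linarith)) h1.le
      · rw [Real.zero_rpow hs1.ne']; positivity)
  obtain ⟨φ, hφ, hφx⟩ := hf.exists_rpow (m := 1 / m) (by rw [le_div_iff₀ hm0]; linarith)
  obtain ⟨k, hk, hkx, hkn⟩ := hT.exists_op_le_const_add hC hD ht hφ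
  rw [← ha] at hkx
  rw [← he] at hkn
  set J := ∫ x, w x ^ s ∂μ with hJ
  have hJ0 : 0 ≤ J := integral_nonneg_of_ae (by
    filter_upwards [hw.nonneg] with x hx using Real.rpow_nonneg hx s)
  have hφJ : ‖φ‖ ^ 2 = J := by
    rw [IsTest.norm_sq_eq]
    refine integral_congr_ae ?_
    filter_upwards [hφx, hfx, hw.nonneg] with x h1 h2 h3
    rw [h1, h2, ← Real.rpow_natCast, ← Real.rpow_mul h3, ← Real.rpow_mul h3]
    congr 1
    rw [hm]
    push_cast
    field_simp
  have hJv : J = ∫ x, v x * T.op t f x ∂μ := by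
    have h1 : ⟪v, T.op t f⟫_ℝ = J := by
      rw [← T.symm, L2.inner_def]
      refine integral_congr_ae ?_
      filter_upwards [hwv, hfx] with x h1 h2
      rw [h2]
      simp only [real_inner_eq_mul]
      rw [h1]
      split_ifs with h
      · have h3 : 0 < T.op t v x := hε.trans h
        rw [mul_comm, ← Real.rpow_add_one h3.ne', sub_add_cancel]
      · rw [Real.zero_rpow hs1.ne', Real.zero_rpow hs0.ne', mul_zero]
    rw [← h1, L2.inner_def]
    simp only [real_inner_eq_mul]
  have hconj : s.HolderConjugate (2 / m) := by
    rw [Real.holderConjugate_iff]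
    refine ⟨hs, ?_⟩
    rw [hm]
    field_simp
    ring
  have hTf : ∀ᵐ x ∂μ, T.op t f x ≤ (a * ‖φ‖) ^ m + k x ^ m := by
    filter_upwards [T.op_rpow_le t hf.nonneg (by rw [le_div_iff₀ hm0]; linarith) hφx, hkx,
      hk.nonneg, (T.op_isTest t hf).nonneg] with x h1 h2 h3 h4
    calc T.op t f x = (T.op t f x ^ (1 / m)) ^ m := by
          rw [← Real.rpow_mul h4, one_div_mul_cancel hm0.ne', Real.rpow_one]
      _ ≤ (a * ‖φ‖ + k x) ^ m := Real.rpow_le_rpow (by positivity) (h1.trans h2) hm0.le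
      _ ≤ _ := Real.rpow_add_le_add_rpow (by positivity) h3 hm0.le hm1
  have hk2 : MemLp (fun x => k x ^ m) (ENNReal.ofReal (2 / m)) μ := by
    have h1 := (Lp.memLp k).norm_rpow_div (ENNReal.ofReal m)
    rw [ENNReal.toReal_ofReal hm0.le] at h1
    rw [ENNReal.ofReal_div_of_pos hm0, ENNReal.ofReal_ofNat]
    refine (memLp_congr_ae ?_).1 h1
    filter_upwards [hk.nonneg] with x hx
    rw [Real.norm_of_nonneg hx]
  have hvs : MemLp v (ENNReal.ofReal s) μ :=
    ⟨Lp.aestronglyMeasurable v, by rw [hv.eLpNorm_eq hs.le]; exact ENNReal.ofReal_lt_top⟩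
  have hvk : Integrable (fun x => v x * k x ^ m) μ := by
    have : ENNReal.HolderConjugate (ENNReal.ofReal s) (ENNReal.ofReal (2 / m)) := hconj.ennrealOfReal
    exact hvs.integrable_mul hk2
  have hholder : ∫ x, v x * k x ^ m ∂μ ≤
      (∫ x, v x ^ s ∂μ) ^ (1 / s) * (∫ x, (k x ^ m) ^ (2 / m) ∂μ) ^ (1 / (2 / m)) :=
    integral_mul_le_Lp_mul_Lq_of_nonneg hconj hv.nonneg
      (by filter_upwards [hk.nonneg] with x hx using Real.rpow_nonneg hx _) hvs hk2
  have hk3 : ∫ x, (k x ^ m) ^ (2 / m) ∂μ = ‖k‖ ^ 2 := by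
    rw [IsTest.norm_sq_eq]
    refine integral_congr_ae ?_
    filter_upwards [hk.nonneg] with x hx
    rw [← Real.rpow_mul hx, mul_div_cancel₀ _ hm0.ne', Real.rpow_ofNat]
  have hpow : (‖k‖ ^ 2) ^ (1 / (2 / m)) = ‖k‖ ^ m := by
    rw [← Real.rpow_natCast, ← Real.rpow_mul (norm_nonneg _)]
    congr 1
    push_cast
    field_simp
  rw [hk3, hpow] at hholder
  set V := (∫ x, v x ^ s ∂μ) ^ (1 / s) with hV
  have hV0 : 0 ≤ V := Real.rpow_nonneg (integral_nonneg_of_ae (by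
    filter_upwards [hv.nonneg] with x hx using Real.rpow_nonneg hx s)) _
  have hmain : J ≤ ‖φ‖ ^ m * (a ^ m * ∫ x, v x ∂μ + e ^ m * V) := by
    calc J ≤ ∫ x, ((a * ‖φ‖) ^ m * v x + v x * k x ^ m) ∂μ := by
          rw [hJv]
          refine integral_mono_ae ?_ ((hv.integrable.const_mul _).add hvk) ?_
          · have h1 := L2.integrable_inner (𝕜 := ℝ) v (T.op t f)
            simpa only [real_inner_eq_mul] using h1
          · filter_upwards [hTf, hv.nonneg] with x h1 h2
            have := mul_le_mul_of_nonneg_left h1 h2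
            linarith
      _ = (a * ‖φ‖) ^ m * ∫ x, v x ∂μ + ∫ x, v x * k x ^ m ∂μ := by
          rw [integral_add (hv.integrable.const_mul _) hvk, integral_const_mul]
      _ ≤ (a * ‖φ‖) ^ m * ∫ x, v x ∂μ + V * (e * ‖φ‖) ^ m := by
          refine add_le_add_right (hholder.trans ?_) _
          exact mul_le_mul_of_nonneg_left (Real.rpow_le_rpow (norm_nonneg _) hkn hm0.le) hV0
      _ = _ := by
          rw [Real.mul_rpow ha0.le (norm_nonneg _), Real.mul_rpow he0.le (norm_nonneg _)]
          ring
  -- Dividing by this factor turns `∫ w^s` into its `s`-th root.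
  have hφm : ‖φ‖ ^ m = J ^ (1 - 1 / s) := by
    rw [← hφJ, ← Real.rpow_natCast, ← Real.rpow_mul (norm_nonneg _)]
    congr 1
    rw [hm]
    push_cast
    field_simp
  rcases hJ0.eq_or_lt with h | h
  · rw [← h, Real.zero_rpow (by positivity)]
    have : 0 ≤ ∫ x, v x ∂μ := integral_nonneg_of_ae hv.nonneg
    positivity
  · have h1 : J ^ (1 / s) * J ^ (1 - 1 / s) = J := by
      rw [← Real.rpow_add h, add_sub_cancel, Real.rpow_one]
    rw [hφm] at hmain
    have h2 : 0 < J ^ (1 - 1 / s) := by positivity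
    refine le_of_mul_le_mul_right ?_ h2
    rw [h1]
    linarith

end SymmMarkovSemigroup

end

/-! ### Decay between general exponents -/

section

variable {α : Type*} [MeasurableSpace α] {μ : Measure α}

theorem eLpNorm_rpow_of_nonneg {f : α → ℝ} (hf : ∀ᵐ x ∂μ, 0 ≤ f x) {p m : ℝ} (hp : 0 ≤ p)
    (hm : 0 < m) :
    eLpNorm (fun x => f x ^ m) (ENNReal.ofReal p) μ = eLpNorm f (ENNReal.ofReal (p * m)) μ ^ m := by
  rw [ENNReal.ofReal_mul hp, ← eLpNorm_norm_rpow f hm]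
  refine eLpNorm_congr_ae ?_
  filter_upwards [hf] with x hx
  rw [Real.norm_of_nonneg hx]

theorem eLpNorm_mono_of_nonneg {f g : α → ℝ} {p : ℝ≥0∞} (hf : ∀ᵐ x ∂μ, 0 ≤ f x)
    (h : ∀ᵐ x ∂μ, f x ≤ g x) : eLpNorm f p μ ≤ eLpNorm g p μ := by
  refine eLpNorm_mono_ae ?_
  filter_upwards [hf, h] with x h1 h2
  rw [Real.norm_of_nonneg h1, Real.norm_of_nonneg (h1.trans h2)]
  exact h2

namespace SymmMarkovSemigroup

variable {T : SymmMarkovSemigroup μ}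

theorem eLpNorm_op_rpow_le (t : ℝ≥0) {f g : Lp ℝ 2 μ} (hf : IsTest f) {m s : ℝ} (hm : 1 ≤ m)
    (hs : 0 ≤ s) (hg : g =ᵐ[μ] fun x => f x ^ m) :
    eLpNorm (T.op t f) (ENNReal.ofReal (s * m)) μ ^ m ≤
      eLpNorm (T.op t g) (ENNReal.ofReal s) μ := by
  have hTf := (T.op_isTest t hf).nonneg
  rw [← eLpNorm_rpow_of_nonneg hTf hs (by linarith)]
  refine eLpNorm_mono_of_nonneg ?_ (T.op_rpow_le t hf.nonneg hm hg)
  filter_upwards [hTf] with x hx using Real.rpow_nonneg hx m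

/-- By Jensen, `(T_t f)^p ≤ T_t (f^p)`, and `T_t` contracts `L¹`. -/
theorem eLpNorm_op_le (t : ℝ≥0) {f : Lp ℝ 2 μ} (hf : IsTest f) {p : ℝ} (hp : 1 ≤ p) :
    eLpNorm (T.op t f) (ENNReal.ofReal p) μ ≤ eLpNorm f (ENNReal.ofReal p) μ := by
  obtain ⟨g, hg, hgf⟩ := hf.exists_rpow hp
  have h1 := eLpNorm_op_rpow_le (T := T) t hf hp zero_le_one hgf
  have h2 := eLpNorm_rpow_of_nonneg hf.nonneg zero_le_one (by linarith : 0 < p)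
  rw [one_mul, ENNReal.ofReal_one] at h1 h2
  rw [← eLpNorm_congr_ae hgf] at h2
  have h3 := h1.trans (T.eLpNorm_one_op_le t g hg.memLp_one)
  rw [h2] at h3
  exact (ENNReal.rpow_le_rpow_iff (by linarith : 0 < p)).1 h3

variable (T) in
/-- Decay `Lᵠ → Lᵖ` at the rate `D (1/q - 1/p)`, up to an exponentially small error in `Lᵖ`. -/
def HasDecay (D q p : ℝ) : Prop :=
  ∃ C c τ : ℝ, 0 < C ∧ 0 < c ∧ 0 < τ ∧ ∀ t : ℝ≥0, τ ≤ t → ∀ f : Lp ℝ 2 μ, IsTest f →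
    eLpNorm (T.op t f) (ENNReal.ofReal p) μ ≤
      ENNReal.ofReal (C * (t : ℝ) ^ (-(D * (1 / q - 1 / p)))) * eLpNorm f (ENNReal.ofReal q) μ +
      ENNReal.ofReal (C * Real.exp (-(c * t))) * eLpNorm f (ENNReal.ofReal p) μ

/-- The truncation bound does not depend on the level `ε`, so levels `1/(n+1)` and Fatou's lemma
give the estimate for `T_t f` itself. -/
theorem HasNashInequality.hasDecay_of_le_two {C D s : ℝ} (hT : T.HasNashInequality C D)
    (hC : 0 < C) (hD : 0 < D) (hs : 1 < s) (hs2 : s ≤ 2) : T.HasDecay D 1 s := by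
  have hs0 : 0 < s := by linarith
  have hs1 : 0 < s - 1 := by linarith
  set m := 2 * (s - 1) / s with hm
  have hm0 : 0 < m := by positivity
  set A : ℝ := ((2 * 4 ^ D / C) ^ (D / 2)) ^ m with hA
  have hA0 : 0 < A := by positivity
  refine ⟨A + 1, C * m / 2, 1, by positivity, by positivity, one_pos, fun t ht f hf => ?_⟩
  have ht0 : (0 : ℝ) < t := by linarith
  have ht0' : 0 < t := by exact_mod_cast ht0
  have hu := T.op_isTest t hf
  set V := (∫ x, f x ^ s ∂μ) ^ (1 / s) with hV
  have hI0 : 0 ≤ ∫ x, f x ∂μ := integral_nonneg_of_ae hf.nonneg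
  have hV0 : 0 ≤ V := Real.rpow_nonneg (integral_nonneg_of_ae (by
    filter_upwards [hf.nonneg] with x hx using Real.rpow_nonneg hx s)) _
  have e1 : ((2 * 4 ^ D / C / (t : ℝ)) ^ (D / 2)) ^ m = A * (t : ℝ) ^ (-(D * (1 / 1 - 1 / s))) := by
    rw [Real.div_rpow (by positivity) ht0.le, Real.div_rpow (by positivity) (by positivity), ← hA,
      ← Real.rpow_mul ht0.le, Real.rpow_neg ht0.le, div_eq_mul_inv]
    congr 3
    rw [hm]
    field_simp
  have e2 : Real.exp (-(C * t / 2)) ^ m = Real.exp (-(C * m / 2 * t)) := by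
    rw [← Real.exp_mul]; congr 1; ring
  have hbound : ∀ n : ℕ, eLpNorm (fun x => if 1 / ((n : ℝ) + 1) < T.op t f x then T.op t f x else 0)
      (ENNReal.ofReal s) μ ≤
      ENNReal.ofReal (A * (t : ℝ) ^ (-(D * (1 / 1 - 1 / s))) * ∫ x, f x ∂μ +
        Real.exp (-(C * m / 2 * t)) * V) := by
    intro n
    obtain ⟨w, hw, hwx⟩ := hu.exists_of_le (C := 1)
      (φ := fun x => if 1 / ((n : ℝ) + 1) < T.op t f x then T.op t f x else 0) (by
        have hms : Measurable (T.op t f) := (Lp.stronglyMeasurable _).measurable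
        exact (Measurable.ite (measurableSet_lt measurable_const hms) hms
          measurable_const).aestronglyMeasurable)
      (by filter_upwards [hu.nonneg] with x hx; split_ifs <;> simp [hx])
      (by filter_upwards [hu.nonneg] with x hx; split_ifs <;> simp [hx])
    have h := hT.integral_truncation_le hC hD hs hs2 (by positivity : 0 < 1 / ((n : ℝ) + 1)) ht0'
      hf hw hwx
    rw [e1, e2] at h
    rw [← eLpNorm_congr_ae hwx, hw.eLpNorm_eq hs.le]
    exact ENNReal.ofReal_le_ofReal h
  have hlim : ∀ᵐ x ∂μ, Tendsto (fun n : ℕ =>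
      if 1 / ((n : ℝ) + 1) < T.op t f x then T.op t f x else 0) atTop (𝓝 (T.op t f x)) := by
    filter_upwards [hu.nonneg] with x hx
    rcases hx.eq_or_lt with h | h
    · simp [← h]
    · refine tendsto_const_nhds.congr' ?_
      filter_upwards [(tendsto_one_div_add_atTop_nhds_zero_nat (𝕜 := ℝ)).eventually
        (gt_mem_nhds h)] with n hn
      rw [if_pos hn]
  have hfin := Lp.eLpNorm_le_of_ae_tendsto (Eventually.of_forall hbound) (fun n => by
    have hms : Measurable (T.op t f) := (Lp.stronglyMeasurable _).measurable
    exact (Measurable.ite (measurableSet_lt measurable_const hms) hms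
      measurable_const).aestronglyMeasurable) hlim
  refine hfin.trans ?_
  rw [ENNReal.ofReal_one, hf.eLpNorm_one_eq, hf.eLpNorm_eq hs.le, ← hV,
    ← ENNReal.ofReal_mul (by positivity), ← ENNReal.ofReal_mul (by positivity),
    ← ENNReal.ofReal_add (by positivity) (by positivity)]
  refine ENNReal.ofReal_le_ofReal ?_
  gcongr
  · linarith
  · exact le_mul_of_one_le_left (Real.exp_pos _).le (by linarith)

/-- Apply the bound to `f^q`, use Jensen on the left and take `q`-th roots; the rate `D(1 - 1/s)`
becomes `D(1/q - 1/(sq))`. -/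
theorem HasDecay.rpow {D s q : ℝ} (h : T.HasDecay D 1 s) (hs : 1 ≤ s) (hq : 1 ≤ q) :
    T.HasDecay D q (s * q) := by
  obtain ⟨C, c, τ, hC, hc, hτ, h⟩ := h
  have hq0 : 0 < q := by linarith
  have hs0 : 0 < s := by linarith
  refine ⟨C ^ (1 / q), c / q, τ, by positivity, by positivity, hτ, fun t ht f hf => ?_⟩
  have ht0 : (0 : ℝ) < t := by linarith
  obtain ⟨g, hg, hgf⟩ := hf.exists_rpow hq
  have h1 := (eLpNorm_op_rpow_le (T := T) t hf hq hs0.le hgf).trans (h t ht g hg)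
  rw [eLpNorm_congr_ae hgf, eLpNorm_congr_ae hgf, eLpNorm_rpow_of_nonneg hf.nonneg hs0.le hq0,
    eLpNorm_rpow_of_nonneg hf.nonneg zero_le_one hq0, one_mul] at h1
  have h2 := ENNReal.rpow_le_rpow h1 (by positivity : 0 ≤ 1 / q)
  rw [← ENNReal.rpow_mul, mul_one_div_cancel hq0.ne', ENNReal.rpow_one] at h2
  refine h2.trans ((ENNReal.rpow_add_le_add_rpow _ _ (by positivity)
    (by rw [div_le_one hq0]; exact hq)).trans (le_of_eq ?_))
  rw [ENNReal.mul_rpow_of_nonneg _ _ (by positivity), ENNReal.mul_rpow_of_nonneg _ _ (by positivity),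
    ← ENNReal.rpow_mul, ← ENNReal.rpow_mul, mul_one_div_cancel hq0.ne', ENNReal.rpow_one,
    ENNReal.rpow_one, ENNReal.ofReal_rpow_of_nonneg (by positivity) (by positivity),
    ENNReal.ofReal_rpow_of_nonneg (by positivity) (by positivity),
    Real.mul_rpow hC.le (by positivity), Real.mul_rpow hC.le (by positivity),
    ← Real.rpow_mul ht0.le, ← Real.exp_mul]
  congr 5
  · field_simp
  · field_simp

theorem eventually_exp_neg_le_rpow_neg {c : ℝ} (hc : 0 < c) (M x : ℝ) :
    ∀ᶠ t : ℝ in atTop, M * Real.exp (-(c * t)) ≤ t ^ (-x) := by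
  have h := (tendsto_rpow_mul_exp_neg_mul_atTop_nhds_zero x c hc).const_mul M
  rw [mul_zero] at h
  filter_upwards [h.eventually (gt_mem_nhds one_pos), eventually_gt_atTop 0] with t ht ht0
  rw [Real.rpow_neg ht0.le, ← one_div, le_div_iff₀ (by positivity)]
  rw [neg_mul] at ht
  linarith

theorem HasDecay.trans {D b p : ℝ} (hD : 0 < D) (h₁ : T.HasDecay D 1 b) (h₂ : T.HasDecay D b p)
    (hb : 1 ≤ b) (hbp : b ≤ p) : T.HasDecay D 1 p := by
  obtain ⟨C₁, c₁, τ₁, hC₁, hc₁, hτ₁, h₁⟩ := h₁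
  obtain ⟨C₂, c₂, τ₂, hC₂, hc₂, hτ₂, h₂⟩ := h₂
  have hb0 : 0 < b := by linarith
  have hp0 : 0 < p := by linarith
  set x := D * (1 / 1 - 1 / b) with hx
  set y := D * (1 / b - 1 / p) with hy
  have hy0 : 0 ≤ y := mul_nonneg hD.le (sub_nonneg.2 (one_div_le_one_div_of_le hb0 hbp))
  obtain ⟨S, hS⟩ := eventually_atTop.1 (eventually_exp_neg_le_rpow_neg hc₁ 1 x)
  refine ⟨2 * C₁ * C₂ * 2 ^ (x + y) + C₁ * C₂ + C₂, min c₁ c₂ / 2,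
    2 * max (max τ₁ τ₂) (max S 1), by positivity, by positivity, by positivity,
    fun t ht f hf => ?_⟩
  have ht2 : max (max τ₁ τ₂) (max S 1) ≤ ((t / 2 : ℝ≥0) : ℝ) := by
    push_cast
    linarith
  obtain ⟨⟨ht3, ht4⟩, ht5, ht6⟩ : (τ₁ ≤ ((t / 2 : ℝ≥0) : ℝ) ∧ τ₂ ≤ ((t / 2 : ℝ≥0) : ℝ)) ∧
      S ≤ ((t / 2 : ℝ≥0) : ℝ) ∧ 1 ≤ ((t / 2 : ℝ≥0) : ℝ) := by
    simpa only [max_le_iff] using ht2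
  set s : ℝ≥0 := t / 2 with hs
  have hts : (t : ℝ) = 2 * s := by rw [hs]; push_cast; ring
  have hs0 : (0 : ℝ) < s := by linarith
  have hg := T.op_isTest s hf
  have e0 : T.op t f = T.op s (T.op s f) := by rw [← T.op_add_apply, hs, add_halves]
  rw [e0]
  set N₁ := eLpNorm f (ENNReal.ofReal 1) μ
  set Np := eLpNorm f (ENNReal.ofReal p) μ
  have hA : eLpNorm (T.op s f) (ENNReal.ofReal b) μ ≤
      ENNReal.ofReal (2 * C₁ * (s : ℝ) ^ (-x)) * N₁ +
        ENNReal.ofReal (C₁ * Real.exp (-(c₁ * s))) * Np := by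
    refine (h₁ s ht3 f hf).trans ?_
    -- The error at the intermediate exponent `b` is split between the end exponents: its `L¹` part
    -- joins the main term, since `e^(-c₁ s) ≤ s^(-x)` for large `s`.
    have h3 : eLpNorm f (ENNReal.ofReal b) μ ≤ N₁ + Np :=
      eLpNorm_le_add_of_le_of_le (Lp.aestronglyMeasurable f) one_pos hb hbp
    have h4 := hS s ht5
    rw [one_mul] at h4
    calc _ ≤ ENNReal.ofReal (C₁ * (s : ℝ) ^ (-x)) * N₁ +
          ENNReal.ofReal (C₁ * Real.exp (-(c₁ * s))) * (N₁ + Np) := by gcongr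
      _ = (ENNReal.ofReal (C₁ * (s : ℝ) ^ (-x)) + ENNReal.ofReal (C₁ * Real.exp (-(c₁ * s)))) * N₁
          + ENNReal.ofReal (C₁ * Real.exp (-(c₁ * s))) * Np := by ring
      _ ≤ _ := by
          gcongr
          rw [← ENNReal.ofReal_add (by positivity) (by positivity)]
          refine ENNReal.ofReal_le_ofReal ?_
          have := mul_le_mul_of_nonneg_left h4 hC₁.le
          linarith
  have hB : eLpNorm (T.op s f) (ENNReal.ofReal p) μ ≤ Np := eLpNorm_op_le s hf (hb.trans hbp)
  have hsy : (s : ℝ) ^ (-y) ≤ 1 := Real.rpow_le_one_of_one_le_of_nonpos ht6 (by linarith)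
  have hxy : D * (1 / 1 - 1 / p) = x + y := by rw [hx, hy]; ring
  rw [hxy]
  calc _ ≤ ENNReal.ofReal (C₂ * (s : ℝ) ^ (-y)) * eLpNorm (T.op s f) (ENNReal.ofReal b) μ +
        ENNReal.ofReal (C₂ * Real.exp (-(c₂ * s))) * eLpNorm (T.op s f) (ENNReal.ofReal p) μ :=
        h₂ s ht4 _ hg
    _ ≤ ENNReal.ofReal (C₂ * (s : ℝ) ^ (-y)) * (ENNReal.ofReal (2 * C₁ * (s : ℝ) ^ (-x)) * N₁ +
        ENNReal.ofReal (C₁ * Real.exp (-(c₁ * s))) * Np) +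
        ENNReal.ofReal (C₂ * Real.exp (-(c₂ * s))) * Np := by gcongr
    _ = ENNReal.ofReal (C₂ * (s : ℝ) ^ (-y) * (2 * C₁ * (s : ℝ) ^ (-x))) * N₁ +
        ENNReal.ofReal (C₂ * (s : ℝ) ^ (-y) * (C₁ * Real.exp (-(c₁ * s))) +
          C₂ * Real.exp (-(c₂ * s))) * Np := by
        rw [ENNReal.ofReal_add (by positivity) (by positivity),
          ENNReal.ofReal_mul (p := C₂ * (s : ℝ) ^ (-y)) (by positivity),
          ENNReal.ofReal_mul (p := C₂ * (s : ℝ) ^ (-y)) (by positivity)]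
        ring
    _ ≤ _ := by
        have hmin1 : Real.exp (-(c₁ * s)) ≤ Real.exp (-(min c₁ c₂ / 2 * t)) := by
          rw [hts]
          refine Real.exp_le_exp.2 ?_
          nlinarith [min_le_left c₁ c₂]
        have hmin2 : Real.exp (-(c₂ * s)) ≤ Real.exp (-(min c₁ c₂ / 2 * t)) := by
          rw [hts]
          refine Real.exp_le_exp.2 ?_
          nlinarith [min_le_right c₁ c₂]
        set E := Real.exp (-(min c₁ c₂ / 2 * t))
        have hE0 : 0 < E := Real.exp_pos _
        refine add_le_add (mul_le_mul' (ENNReal.ofReal_le_ofReal ?_) le_rfl)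
          (mul_le_mul' (ENNReal.ofReal_le_ofReal ?_) le_rfl)
        · have e1 : C₂ * (s : ℝ) ^ (-y) * (2 * C₁ * (s : ℝ) ^ (-x)) =
              2 * C₁ * C₂ * 2 ^ (x + y) * (t : ℝ) ^ (-(x + y)) := by
            rw [hts, Real.mul_rpow (by norm_num) hs0.le, neg_add, Real.rpow_add hs0, ← neg_add,
              Real.rpow_neg (by norm_num : (0 : ℝ) ≤ 2)]
            field_simp
          rw [e1]
          gcongr
          have : 0 < C₁ * C₂ := by positivity
          linarith
        · calc C₂ * (s : ℝ) ^ (-y) * (C₁ * Real.exp (-(c₁ * s))) + C₂ * Real.exp (-(c₂ * s))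
              ≤ C₂ * 1 * (C₁ * E) + C₂ * E := by gcongr
            _ = (C₁ * C₂ + C₂) * E := by ring
            _ ≤ _ := by
                gcongr
                have : 0 < 2 * C₁ * C₂ * 2 ^ (x + y) := by positivity
                linarith

/-- Duality stops at `s = 2`. Beyond it, compose `L¹ → L^(s/2)` with the power-transformed bound
`L^(s/2) → L^s`, inducting on dyadic size. -/
theorem HasNashInequality.hasDecay_one {C D : ℝ} (hT : T.HasNashInequality C D)
    (hC : 0 < C) (hD : 0 < D) {s : ℝ} (hs : 1 < s) : T.HasDecay D 1 s := by
  obtain ⟨n, hn⟩ := pow_unbounded_of_one_lt s (by norm_num : (1 : ℝ) < 2)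
  induction n generalizing s with
  | zero => rw [pow_zero] at hn; linarith
  | succ n ih =>
    rcases le_or_gt s 2 with h | h
    · exact hT.hasDecay_of_le_two hC hD hs h
    · have h1 := ih (s := s / 2) (by linarith) (by rw [pow_succ] at hn; linarith)
      have h2 := (hT.hasDecay_of_le_two hC hD one_lt_two le_rfl).rpow (q := s / 2)
        one_le_two (by linarith)
      rw [mul_div_cancel₀ _ two_ne_zero] at h2
      exact h1.trans hD h2 (by linarith) (by linarith)

theorem HasNashInequality.hasDecay {C D : ℝ} (hT : T.HasNashInequality C D)
    (hC : 0 < C) (hD : 0 < D) {q p : ℝ} (hq : 1 ≤ q) (hqp : q < p) : T.HasDecay D q p := by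
  have hq0 : 0 < q := by linarith
  have h1 : 1 < p / q := by rwa [one_lt_div hq0]
  have h := (hT.hasDecay_one hC hD h1).rpow h1.le hq
  rwa [div_mul_cancel₀ _ hq0.ne'] at h

end SymmMarkovSemigroup

end

/-! ### Extension to `L¹` and absorption of the error -/

section

variable {α : Type*} [MeasurableSpace α] {μ : Measure α}

/-- The truncations `v 1_{|v| ≤ n}` of an integrable function. -/
theorem exists_seq_bounded_tendsto (v : Lp ℝ 1 μ) :
    ∃ V : ℕ → Lp ℝ 1 μ, Tendsto V atTop (𝓝 v) ∧
      ∀ n, (∀ᵐ x ∂μ, |V n x| ≤ |v x|) ∧ ∀ᵐ x ∂μ, |V n x| ≤ n := by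
  have hvm : Measurable v := (Lp.stronglyMeasurable v).measurable
  have hE : ∀ n : ℕ, MeasurableSet {x | |v x| ≤ n} := fun n =>
    measurableSet_le hvm.abs measurable_const
  have hmem : ∀ n : ℕ, MemLp (Set.indicator {x | |v x| ≤ n} v) 1 μ :=
    fun n => (Lp.memLp v).indicator (hE n)
  refine ⟨fun n => (hmem n).toLp _, ?_, fun n => ⟨?_, ?_⟩⟩
  · have hdom := tendsto_lintegral_of_dominated_convergence' (μ := μ)
      (F := fun (n : ℕ) x => ‖Set.indicator {x | |v x| ≤ n} v x - v x‖ₑ) (f := fun _ => 0)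
      (fun x => ‖v x‖ₑ)
      (fun n => ((hvm.indicator (hE n)).sub hvm).enorm.aemeasurable)
      (fun n => Eventually.of_forall fun x => by
        by_cases h : |v x| ≤ n <;> simp [Set.indicator, h])
      (by rw [← eLpNorm_one_eq_lintegral_enorm]; exact Lp.eLpNorm_ne_top v)
      (Eventually.of_forall fun x => by
        obtain ⟨m, hm⟩ := exists_nat_ge |v x|
        refine tendsto_const_nhds.congr' ?_
        filter_upwards [eventually_ge_atTop m] with n hn
        have : |v x| ≤ n := hm.trans (by exact_mod_cast hn)
        simp [Set.indicator, this])
    rw [lintegral_zero] at hdom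
    rw [Lp.tendsto_Lp_iff_tendsto_eLpNorm']
    refine hdom.congr fun n => ?_
    rw [eLpNorm_one_eq_lintegral_enorm]
    refine lintegral_congr_ae ?_
    filter_upwards [(hmem n).coeFn_toLp] with x h3
    rw [Pi.sub_apply, h3]
  · filter_upwards [(hmem n).coeFn_toLp] with x hx
    rw [hx]
    by_cases h : |v x| ≤ n <;> simp [Set.indicator, h]
  · filter_upwards [(hmem n).coeFn_toLp] with x hx
    rw [hx]
    by_cases h : |v x| ≤ n <;> simp [Set.indicator, h]

theorem memLp_two_of_bdd {v : Lp ℝ 1 μ} {M : ℝ} (h : ∀ᵐ x ∂μ, |v x| ≤ M) : MemLp v 2 μ := by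
  refine (memLp_two_iff_integrable_sq (Lp.aestronglyMeasurable v)).2 ?_
  refine ((memLp_one_iff_integrable.1 (Lp.memLp v)).const_mul M).mono
    ((Lp.aestronglyMeasurable v).pow 2) ?_
  filter_upwards [h] with x hx
  rw [norm_mul, norm_pow, pow_two]
  exact mul_le_mul_of_nonneg_right (hx.trans (le_abs_self M)) (norm_nonneg _)

namespace SymmMarkovSemigroup

variable {T : SymmMarkovSemigroup μ}

/-- Domination by `T_t |v|` reduces signed functions to nonnegative test functions. -/
theorem exists_isTest_opL1_le {v : Lp ℝ 1 μ} {M : ℝ} (h : ∀ᵐ x ∂μ, |v x| ≤ M) :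
    ∃ f : Lp ℝ 2 μ, IsTest f ∧ (f =ᵐ[μ] fun x => |v x|) ∧
      ∀ t, ∀ᵐ x ∂μ, |T.opL1 t v x| ≤ T.op t f x := by
  have h2 := memLp_two_of_bdd h
  have hf : (|h2.toLp v| : Lp ℝ 2 μ) =ᵐ[μ] fun x => |v x| := by
    filter_upwards [Lp.coeFn_abs (h2.toLp v), h2.coeFn_toLp] with x h3 h4
    rw [h3, h4]
  refine ⟨|h2.toLp v|, ⟨?_, ?_, |M| + 1, by positivity, ?_⟩, hf, fun t => ?_⟩
  · filter_upwards [hf] with x hx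
    rw [hx]
    exact abs_nonneg _
  · exact (memLp_congr_ae hf).2 (Lp.memLp v).abs
  · filter_upwards [hf, h] with x hx h3
    rw [hx]
    linarith [le_abs_self M]
  · filter_upwards [T.opL1_ae_eq t v h2, (Lp.coeFn_le _ _).2 (T.abs_op_le t (h2.toLp v)),
      Lp.coeFn_abs (T.op t (h2.toLp v))] with x h3 h4 h5
    rw [h3]
    rwa [h5] at h4

/-- Bounded truncations converge in `L¹`, hence so do their images under `T_t`, and the `Lᵖ` norm is
lower semicontinuous under convergence in measure. -/
theorem HasDecay.eLpNorm_opL1_le {D q p : ℝ} (h : T.HasDecay D q p) :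
    ∃ C c τ : ℝ, 0 < C ∧ 0 < c ∧ 0 < τ ∧ ∀ t : ℝ≥0, τ ≤ t → ∀ v : Lp ℝ 1 μ,
      eLpNorm (T.opL1 t v) (ENNReal.ofReal p) μ ≤
        ENNReal.ofReal (C * (t : ℝ) ^ (-(D * (1 / q - 1 / p)))) * eLpNorm v (ENNReal.ofReal q) μ +
        ENNReal.ofReal (C * Real.exp (-(c * t))) * eLpNorm v (ENNReal.ofReal p) μ := by
  obtain ⟨C, c, τ, hC, hc, hτ, h⟩ := h
  refine ⟨C, c, τ, hC, hc, hτ, fun t ht v => ?_⟩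
  obtain ⟨V, hV, hVb⟩ := exists_seq_bounded_tendsto v
  refine eLpNorm_le_of_tendstoInMeasure (Eventually.of_forall fun n => ?_)
    (tendstoInMeasure_of_tendsto_Lp (((T.opL1 t).continuous.tendsto v).comp hV))
    fun n => Lp.aestronglyMeasurable _
  obtain ⟨h1, h2⟩ := hVb n
  obtain ⟨f, hf, hfV, hle⟩ := exists_isTest_opL1_le (T := T) h2
  have hfv : ∀ e : ℝ≥0∞, eLpNorm f e μ ≤ eLpNorm v e μ := by
    intro e
    refine eLpNorm_mono_ae ?_
    filter_upwards [hfV, h1] with x h3 h4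
    rw [h3, Real.norm_eq_abs, Real.norm_eq_abs, abs_abs]
    exact h4
  calc eLpNorm (T.opL1 t (V n)) (ENNReal.ofReal p) μ ≤ eLpNorm (T.op t f) (ENNReal.ofReal p) μ := by
        refine eLpNorm_mono_ae ?_
        filter_upwards [hle t] with x hx
        exact hx.trans (le_abs_self _)
    _ ≤ _ := h t ht f hf
    _ ≤ _ := by gcongr <;> exact hfv _

theorem HasDecay.exists_eventually_le {D q p : ℝ} (h : T.HasDecay D q p) (hq : 0 < q) :
    ∃ C : ℝ, 0 < C ∧ ∀ v : Lp ℝ 1 μ, MemLp v (ENNReal.ofReal p) μ →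
      ∃ t₀ : ℝ, 0 < t₀ ∧ ∀ t : ℝ≥0, t₀ < t →
        eLpNorm (T.opL1 t v) (ENNReal.ofReal p) μ ≤
          ENNReal.ofReal (C * (t : ℝ) ^ (-(D * (1 / q - 1 / p)))) *
            eLpNorm v (ENNReal.ofReal q) μ := by
  obtain ⟨C, c, τ, hC, hc, hτ, h⟩ := h.eLpNorm_opL1_le
  refine ⟨C + 1, by positivity, fun v hv => ?_⟩
  rcases eq_or_ne v 0 with rfl | hv0
  · refine ⟨1, one_pos, fun t _ => ?_⟩
    rw [map_zero, eLpNorm_congr_ae (Lp.coeFn_zero ℝ 1 μ), eLpNorm_zero]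
    exact zero_le
  set Nq := eLpNorm v (ENNReal.ofReal q) μ with hNq
  set Np := eLpNorm v (ENNReal.ofReal p) μ with hNp
  have hNp_top : Np ≠ ∞ := hv.2.ne
  have hNq0 : Nq ≠ 0 := by
    rw [hNq, Ne, eLpNorm_eq_zero_iff (Lp.aestronglyMeasurable v) (by simpa using hq)]
    exact fun h => hv0 (Lp.eq_zero_iff_ae_eq_zero.2 h)
  -- Only this threshold sees the ratio `‖v‖_p / ‖v‖_q`; beyond it the error costs at most `1` in
  -- the constant, whence `C + 1`.
  obtain ⟨S, hS⟩ := eventually_atTop.1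
    (eventually_exp_neg_le_rpow_neg hc (C * (Np / Nq).toReal) (D * (1 / q - 1 / p)))
  refine ⟨max τ S, lt_max_of_lt_left hτ, fun t ht => ?_⟩
  obtain ⟨ht1, ht2⟩ := max_lt_iff.1 ht
  have ht0 : (0 : ℝ) < t := hτ.trans ht1
  rcases eq_or_ne Nq ∞ with hq_top | hq_top
  · rw [hq_top, ENNReal.mul_top (by simpa using by positivity)]
    exact le_top
  have hdiv : Np = ENNReal.ofReal (Np / Nq).toReal * Nq := by
    rw [ENNReal.ofReal_toReal (ENNReal.div_ne_top hNp_top hNq0),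
      ENNReal.div_mul_cancel hNq0 hq_top]
  refine (h t ht1.le v).trans ?_
  rw [← hNp, ← hNq, hdiv, ← mul_assoc, ← ENNReal.ofReal_mul (by positivity), ← add_mul,
    ← ENNReal.ofReal_add (by positivity) (by positivity)]
  gcongr
  have := hS t ht2.le
  linarith

end SymmMarkovSemigroup

end

theorem mainTheorem2 {N : ℕ}
    (T : SymmMarkovSemigroup (volume : Measure (EuclideanSpace ℝ (Fin N))))
    (r d C₁ : ℝ) (hr₁ : 1 ≤ r) (hr₂ : r < 2) (hd : 0 < d) (hC₁ : 0 < C₁)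
    (hNash : ∀ f : Lp ℝ 2 (volume : Measure (EuclideanSpace ℝ (Fin N))),
      f ∈ T.formDomain → MemLp f 1 volume → eLpNorm f (ENNReal.ofReal r) volume = 1 →
      C₁ * ‖f‖ ^ 2 * min 1 (‖f‖ ^ (2 / d)) ≤ T.form f f)
    (q p : ℝ) (hq : 1 ≤ q) (hqp : q < p) :
    ∃ C₂ : ℝ, 0 < C₂ ∧
      ∀ v : Lp ℝ 1 (volume : Measure (EuclideanSpace ℝ (Fin N))),
        MemLp v (ENNReal.ofReal p) volume →
        ∃ t₀ : ℝ, 0 < t₀ ∧ ∀ t : ℝ≥0, t₀ < t →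
          eLpNorm (T.opL1 t v) (ENNReal.ofReal p) volume ≤
            ENNReal.ofReal (C₂ * (t : ℝ) ^ (-(d * r / (2 - r) * (1 / q - 1 / p)))) *
              eLpNorm v (ENNReal.ofReal q) volume := by
  have hD : 0 < d * r / (2 - r) := div_pos (by positivity) (by linarith)
  exact ((SymmMarkovSemigroup.hasNashInequality_of_norm_eq_one hr₁ hr₂ hd hC₁ hNash).hasDecay hC₁ hD
    hq hqp).exists_eventually_le (by linarith)
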